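/- Consider a two-player zero-sum matrix game with finite non-empty action sets $\mathcal A,\mathcal B$, $K=|\mathcal A|+|\mathcal B|$. Each pair $(a,b)$ carries a probability law on $[0,1]$ with mean $\ell(a,b)$; for mixed policies put $\ell(\mu,\nu)=\sum_{a,b}\mu(a)\nu(b)\ell(a,b)$ and $$\mathrm{EG}(\mu,\nu)=\max_{\nu'\in\Delta_{\mathcal B}}\ell(\mu,\nu')-\min_{\mu'\in\Delta_{\mathcal A}}\ell(\mu',\nu).$$ At each round $t=0,1,2,\dots$, given the past, the min-player draws $a^t\sim\mu^t$ and the max-player independently draws $b^t\sim\nu^t$; a loss $\ell^t\in[0,1]$ is then drawn from the law attached to $(a^t,b^t)$. Each player observes their own action and $\ell^t$. Let $\eta,\tau,\delta>0$, let $T_0\ge 2$ be an integer, and put $\eta^t=\eta\,(t+T_0)^{-3/4}$, $\tau^t=\tau\log\!\big(\tfrac{t+T_0}{\delta}\big)(t+T_0)^{-1/4}$. With the log-barrier $\Psi(w)=-\sum_i\log w_i$ and its Bregman divergence $D_\Psi(w,w')=\Psi(w)-\Psi(w')-\langle\nabla\Psi(w'),w-w'\rangle$, the players run regularized mirror descent: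 $\mu^0$ and $\nu^0$ are uniform and $$\mu^{t+1}=\operatorname*{argmin}_{\mu\in\Delta_{\mathcal A}}\;D_\Psi(\mu,\mu^t)+\eta^t\langle\hat\ell^t_{\min},\mu\rangle,\qquad \nu^{t+1}=\operatorname*{argmin}_{\nu\in\Delta_{\mathcal B}}\;D_\Psi(\nu,\nu^t)+\eta^t\langle\hat\ell^t_{\max},\nu\rangle,$$ $$\hat\ell^t_{\min}(a)=\frac{\ell^t}{\mu^t(a)}\mathbf 1_{a=a^t}+\tau^t\,\nabla\Psi(\mu^t)_a,\qquad \hat\ell^t_{\max}(b)=\frac{1-\ell^t}{\nu^t(b)}\mathbf 1_{b=b^t}+\tau^t\,\nabla\Psi(\nu^t)_b .$$ **Theorem.** For every $K$ and every $\delta>0$ there is a constant $c=c(K,\delta)>0$ such that the following holds for every such game with $|\mathcal A|+|\mathcal B|=K$. If $$\frac1{\eta\tau}\le c,\qquad \eta\le c,\qquad \eta\tau\le\frac{T_0}{\log(T_0)^4},\qquad T_0\le\log(1/\delta)^2\,\tau^4,$$ then with probability at least $1-\delta$, simultaneously for all $t\ge 0$, $$\mathrm{EG}(\mu^t,\nu^t)\le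 2K\tau\log\!\Big(\frac{t+T_0}{\delta}\Big)(t+T_0)^{-1/4}.$$ -/

import Mathlib

open MeasureTheory ProbabilityTheory

noncomputable section

/-- A two-player zero-sum matrix game with stochastic losses: playing the pair of actions `(a, b)`
produces a random loss in `[0, 1]` with law `law a b`. -/
structure MatrixGame (A B : Type*) where
  law : A → B → ProbabilityMeasure unitInterval

namespace MatrixGame

variable {A B : Type*}

/-- Expected loss of a pair of actions. -/
def meanLoss (G : MatrixGame A B) (a : A) (b : B) : ℝ :=
  ∫ x, (x : ℝ) ∂(G.law a b : Measure unitInterval)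

variable [Fintype A] [Fintype B]

/-- Expected loss `ℓ(μ, ν)` of a pair of mixed policies. -/
def expectedLoss (G : MatrixGame A B) (μ : A → ℝ) (ν : B → ℝ) : ℝ :=
  ∑ a, ∑ b, μ a * ν b * G.meanLoss a b

/-- The exploitability gap `max_{ν'} ℓ(μ, ν') - min_{μ'} ℓ(μ', ν)`, the policies `μ'` and `ν'`
ranging over the whole simplices. -/
def exploitabilityGap (G : MatrixGame A B) (μ : A → ℝ) (ν : B → ℝ) : ℝ :=
  (⨆ ν' : stdSimplex ℝ B, G.expectedLoss μ ν'.1) - ⨅ μ' : stdSimplex ℝ A, G.expectedLoss μ'.1 ν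

end MatrixGame

section MirrorDescent

variable {I : Type*} [Fintype I] [DecidableEq I]

/-- The gradient of a function on `ℝ^I`, as the vector of its partial derivatives. -/
def grad (f : (I → ℝ) → ℝ) (w : I → ℝ) (i : I) : ℝ :=
  fderiv ℝ f w (Pi.single i 1)

/-- The Bregman divergence `D_Ψ(x, y)`. -/
def bregman (Ψ : (I → ℝ) → ℝ) (x y : I → ℝ) : ℝ :=
  Ψ x - Ψ y - ∑ i, grad Ψ y i * (x i - y i)

/-- The log-barrier. It is only used at vectors with positive coordinates. -/
def logBarrier (w : I → ℝ) : ℝ := -∑ i, Real.log (w i)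

/-- The policies at which the log-barrier is finite. -/
def posSimplex (I : Type*) [Fintype I] : Set (I → ℝ) :=
  {w | (∀ i, 0 < w i) ∧ ∑ i, w i = 1}

theorem grad_logBarrier (w : I → ℝ) (hw : ∀ i, 0 < w i) (i : I) :
    grad (logBarrier (I := I)) w i = -(w i)⁻¹ := by
  have h : HasFDerivAt (logBarrier (I := I))
      (-∑ j, (w j)⁻¹ • (ContinuousLinearMap.proj j : (I → ℝ) →L[ℝ] ℝ)) w := by
    unfold logBarrier
    refine HasFDerivAt.neg (HasFDerivAt.fun_sum fun j _ => ?_)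
    exact (ContinuousLinearMap.proj (R := ℝ) (φ := fun _ : I => ℝ) j).hasFDerivAt.log (hw j).ne'
  unfold grad
  rw [h.fderiv]
  simp [Pi.single_apply]

/-- The learning rate `η^t = η (t + T₀)^(-3/4)`. -/
def learningRate (η : ℝ) (T₀ t : ℕ) : ℝ := η * ((t : ℝ) + T₀) ^ (-(3 / 4) : ℝ)

/-- The regularization strength `τ^t = τ log((t + T₀) / δ) (t + T₀)^(-1/4)`. -/
def regStrength (τ δ : ℝ) (T₀ t : ℕ) : ℝ :=
  τ * Real.log (((t : ℝ) + T₀) / δ) * ((t : ℝ) + T₀) ^ (-(1 / 4) : ℝ)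

/-- The importance-sampling estimate of the loss vector of a player who plays the policy `w`, draws
the action `a` and suffers the loss `x`. -/
def importanceEstimate (w : I → ℝ) (a : I) (x : ℝ) (i : I) : ℝ :=
  if i = a then x / w i else 0

/-- The regularized importance-sampling estimate, used as the step of the mirror descent. -/
def regularizedEstimate (τt : ℝ) (w : I → ℝ) (a : I) (x : ℝ) (i : I) : ℝ :=
  importanceEstimate w a x i + τt * grad logBarrier w i

/-- `w'` is the result of the mirror step from `w` with learning rate `ηt` and step `ξ`, for the
log-barrier: it minimizes `D_Ψ(v, w) + ηt ⟨ξ, v⟩` over the policies `v` (since the log-barrier is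
`+∞` at a policy with a zero coordinate, over those with positive coordinates). -/
def IsMirrorStep (ηt : ℝ) (ξ w w' : I → ℝ) : Prop :=
  w' ∈ posSimplex I ∧
    IsMinOn (fun v => bregman logBarrier v w + ηt * ∑ i, ξ i * v i) (posSimplex I) w'

/-- The sequence of policies `w` of one player is the one computed by the regularized mirror descent
with log-barrier, when the actions that the player draws are `act` and the losses that the
player suffers are `x`. -/
structure IsAlgorithmRun (η τ δ : ℝ) (T₀ : ℕ) (act : ℕ → I) (x : ℕ → ℝ) (w : ℕ → I → ℝ) :
    Prop where
  init : ∀ i, w 0 i = 1 / (Fintype.card I : ℝ)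
  step : ∀ t, IsMirrorStep (learningRate η T₀ t)
    (regularizedEstimate (regStrength τ δ T₀ t) (w t) (act t) (x t)) (w t) (w (t + 1))

end MirrorDescent

/-- The interaction protocol with bandit feedback. The σ-algebra `𝓕 t` is the information available
before round `t` (past actions, past losses, and possibly some extra randomness); the policies are
predictable; given `𝓕 t`, the two actions of round `t` are drawn independently from the policies
`μ t` and `ν t`, and the observed loss is then drawn from the law attached to these actions. -/
structure IsBanditPlay {A B Ω : Type*} [MeasurableSpace A] [MeasurableSpace B]
    [mΩ : MeasurableSpace Ω] (G : MatrixGame A B) (P : Measure Ω) (𝓕 : Filtration ℕ mΩ)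
    (μ : ℕ → Ω → A → ℝ) (ν : ℕ → Ω → B → ℝ)
    (act₁ : ℕ → Ω → A) (act₂ : ℕ → Ω → B) (loss : ℕ → Ω → unitInterval) : Prop where
  measurable_policy₁ : ∀ t, Measurable[𝓕 t] (μ t)
  measurable_policy₂ : ∀ t, Measurable[𝓕 t] (ν t)
  measurable_act₁ : ∀ t, Measurable[𝓕 (t + 1)] (act₁ t)
  measurable_act₂ : ∀ t, Measurable[𝓕 (t + 1)] (act₂ t)
  measurable_loss : ∀ t, Measurable[𝓕 (t + 1)] (loss t)
  cond_law : ∀ (t : ℕ) (a : A) (b : B) (S : Set unitInterval), MeasurableSet S →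
    P⟦{ω | act₁ t ω = a ∧ act₂ t ω = b ∧ loss t ω ∈ S} | 𝓕 t⟧
      =ᵐ[P] fun ω => μ t ω a * ν t ω b * (G.law a b : Measure unitInterval).real S

/-- The condition on the parameters `η`, `τ`, `T₀`, the requirements `1 / (η τ) = o(1)` and
`η = o(1)` being read as smallness up to the constant `c`. -/
structure ParameterCondition (c δ η τ : ℝ) (T₀ : ℕ) : Prop where
  eta_pos : 0 < η
  tau_pos : 0 < τ
  two_le : 2 ≤ T₀
  inv_le : 1 / (η * τ) ≤ c
  eta_le : η ≤ c
  mul_le : η * τ ≤ (T₀ : ℝ) / Real.log T₀ ^ 4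
  le_pow : (T₀ : ℝ) ≤ Real.log (1 / δ) ^ 2 * τ ^ 4

end

/-! The random policies are compared with a deterministic path, `shadow`, obtained by running an
explicit Euler scheme with exact feedback on the regularized game, from the same uniform start.

The path nearly solves the current regularized game. Its quality is measured by `kktResidual`, the
relative defect in the stationarity condition `x i * (F i + λ) = τ`. One step multiplies the
residual by `1 - η τ` to first order; the coupling between the players cancels because the zero-sum
cost operators are skew, and the remaining errors are quadratic in the residual or come from the
slow change of `τ`. Hence the residual never leaves a small ball (`residual_ball_invariant`), and
each point of the path is a best response up to about `τ` times the number of actions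
(`sum_mul_sub_le_of_residual`).

The policies stay near the path. The log-barrier absorbs importance weights: the second-order error
of a mirror step involves only `w i * ξ i`, where the factor `1 / w i` disappears. The barrier's
strong monotonicity and the same skew cancellation show that the conditional expectation of the
total divergence contracts by `1 - η τ / 2` up to an error `5 K (η² + (η τ)²)`
(`logDiv_joint_drift_le`, `IsBanditPlay.setIntegral_totalDiv_le`). The contraction beats the decay
of `τ²`, so the divergence divided by `τ² / 16` is a supermartingale up to errors. These sum to at
most `δ`, thanks to the logarithm in `τ^t`, and a maximal inequality
(`one_sub_le_measureReal_forall_le`) bounds the quotient by `1` at all times with probability at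
least `1 - δ`.

A divergence of at most `τ² / 16` gives `ℓ¹`-distances of order `τ`, which turns near-optimality of
the path into the exploitability bound (`MatrixGame.exploitabilityGap_le`). -/

noncomputable section

/-! ### Log-barrier divergence and mirror steps. -/

section LogBarrier

variable {I J : Type*} [Fintype I] [Fintype J]

/-- The Bregman divergence of the log-barrier in closed form. -/
def logDiv (x y : I → ℝ) : ℝ := ∑ i, (x i / y i - 1 - Real.log (x i / y i))

/-- No upper bound on `g` is needed: the linear term of a step may be large and positive, and only
its negative part has to be controlled. -/
theorem sub_two_mul_sq_le_log_one_add {g : ℝ} (hg : -(1 / 2) ≤ g) :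
    g - 2 * g ^ 2 ≤ Real.log (1 + g) := by
  have h1 : 0 < 1 + g := by linarith
  refine le_trans ?_ (Real.one_sub_inv_le_log_of_pos h1)
  have : 1 - (1 + g)⁻¹ - (g - 2 * g ^ 2) = g ^ 2 * (1 + 2 * g) / (1 + g) := by
    field_simp; ring
  have h2 : 0 ≤ g ^ 2 * (1 + 2 * g) / (1 + g) :=
    div_nonneg (mul_nonneg (sq_nonneg g) (by linarith)) h1.le
  linarith

/-- Write `log r = 2 log √r` and use `log √r ≤ √r - 1`. The square root gives a bound valid for `r`
near `0` and for large `r` alike, so divergence bounds turn into ratio bounds. -/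
theorem sq_sqrt_sub_one_le {r : ℝ} (hr : 0 < r) :
    (√r - 1) ^ 2 ≤ r - 1 - Real.log r := by
  have h1 : Real.log r = 2 * Real.log √r := by
    rw [Real.log_sqrt hr.le]; ring
  have h2 := Real.log_le_sub_one_of_pos (Real.sqrt_pos.2 hr)
  have h3 := Real.sq_sqrt hr.le
  nlinarith

theorem sub_one_sub_log_nonneg {r : ℝ} (hr : 0 < r) : 0 ≤ r - 1 - Real.log r := by
  linarith [Real.log_le_sub_one_of_pos hr]

theorem logDiv_nonneg {x y : I → ℝ} (hx : ∀ i, 0 < x i) (hy : ∀ i, 0 < y i) :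
    0 ≤ logDiv x y :=
  Finset.sum_nonneg fun i _ => sub_one_sub_log_nonneg (div_pos (hx i) (hy i))

theorem logDiv_term_le {x y : I → ℝ} (hx : ∀ i, 0 < x i) (hy : ∀ i, 0 < y i) (i : I) :
    x i / y i - 1 - Real.log (x i / y i) ≤ logDiv x y :=
  Finset.single_le_sum (f := fun i => x i / y i - 1 - Real.log (x i / y i))
    (fun i _ => sub_one_sub_log_nonneg (div_pos (hx i) (hy i))) (Finset.mem_univ i)

/-- The right side is the symmetrized divergence, which is what the regularization produces as a
negative drift; this comparison turns that drift into a contraction of `logDiv`. -/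
theorem logDiv_le_sum_sq {x y : I → ℝ} (hx : ∀ i, 0 < x i) (hy : ∀ i, 0 < y i) :
    logDiv x y ≤ ∑ i, (x i - y i) ^ 2 / (x i * y i) := by
  refine Finset.sum_le_sum fun i _ => ?_
  have h := Real.one_sub_inv_le_log_of_pos (div_pos (hx i) (hy i))
  have h1 := (hx i).ne'
  have h2 := (hy i).ne'
  have : (x i - y i) ^ 2 / (x i * y i) = x i / y i - 1 - (1 - (x i / y i)⁻¹) := by
    field_simp
  linarith

theorem posSimplex_le_one {x : I → ℝ} (hx : x ∈ posSimplex I) (i : I) : x i ≤ 1 := by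
  rw [← hx.2]
  exact Finset.single_le_sum (fun i _ => (hx.1 i).le) (Finset.mem_univ i)

/-- A small divergence bounds the `ℓ¹`-distance. -/
theorem sum_abs_sub_le_of_logDiv_le {x y : I → ℝ} (hx : ∀ i, 0 < x i) (hy : y ∈ posSimplex I)
    {d : ℝ} (hd : 0 ≤ d) (hd1 : d ≤ 1) (h : logDiv x y ≤ d ^ 2) :
    ∑ i, |x i - y i| ≤ 3 * d := by
  have key : ∀ i, |x i - y i| ≤ y i * (3 * d) := by
    intro i
    have hr := div_pos (hx i) (hy.1 i)
    have h1 := (sq_sqrt_sub_one_le hr).trans ((logDiv_term_le hx hy.1 i).trans h)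
    have h2 := abs_le_of_sq_le_sq h1 hd
    have h3 := abs_le.1 h2
    -- Factor `r - 1 = (√r - 1) (√r + 1)`; since `d ≤ 1`, the second factor is at most `3`.
    have h4 : |x i / y i - 1| ≤ 3 * d := by
      have : x i / y i - 1 = (√(x i / y i) - 1) * (√(x i / y i) + 1) := by
        have := Real.sq_sqrt hr.le; nlinarith
      rw [this, abs_mul, mul_comm (3 : ℝ)]
      refine mul_le_mul h2 ?_ (abs_nonneg _) hd
      rw [abs_of_nonneg (by positivity)]; linarith
    have h5 : x i - y i = y i * (x i / y i - 1) := by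
      have := (hy.1 i).ne'; field_simp
    rw [h5, abs_mul, abs_of_pos (hy.1 i)]
    exact mul_le_mul_of_nonneg_left h4 (hy.1 i).le
  calc ∑ i, |x i - y i| ≤ ∑ i, y i * (3 * d) := Finset.sum_le_sum fun i _ => key i
    _ = 3 * d := by rw [← Finset.sum_mul, hy.2, one_mul]

theorem posSimplex_convex : Convex ℝ (posSimplex I) := by
  rintro x ⟨hx, hx'⟩ y ⟨hy, hy'⟩ a b ha hb hab
  refine ⟨fun i => ?_, ?_⟩
  · simp only [Pi.add_apply, Pi.smul_apply, smul_eq_mul]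
    rcases ha.eq_or_lt with rfl | ha
    · have : b = 1 := by linarith
      subst this; simpa using hy i
    · have := mul_pos ha (hx i)
      have := mul_nonneg hb (hy i).le
      linarith
  · simp [Finset.sum_add_distrib, ← Finset.mul_sum, hx', hy', hab]

variable [DecidableEq I]

theorem bregman_logBarrier {x y : I → ℝ} (hx : ∀ i, 0 < x i) (hy : ∀ i, 0 < y i) :
    bregman logBarrier x y = logDiv x y := by
  unfold bregman logBarrier logDiv
  rw [neg_sub_neg, ← Finset.sum_sub_distrib, ← Finset.sum_sub_distrib]
  refine Finset.sum_congr rfl fun i _ => ?_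
  have := grad_logBarrier y hy i
  unfold logBarrier at this
  rw [this, Real.log_div (hx i).ne' (hy i).ne']
  have := (hy i).ne'
  field_simp
  ring

/-- First-order optimality of a mirror step. -/
theorem IsMirrorStep.first_order {ηt : ℝ} {ξ w w' x : I → ℝ} (hw : w ∈ posSimplex I)
    (h : IsMirrorStep ηt ξ w w') (hx : x ∈ posSimplex I) :
    0 ≤ ∑ i, (1 / w i - 1 / w' i + ηt * ξ i) * (x i - w' i) := by
  obtain ⟨hw', hmin⟩ := h
  -- The objective is differentiated along the segment from `w'` to `x`; its right derivative at the
  -- minimizer is nonnegative.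
  have hderiv : HasDerivAt (fun s : ℝ => ∑ i, ((w' i + s * (x i - w' i)) / w i - 1
      - Real.log ((w' i + s * (x i - w' i)) / w i)) + ηt * ∑ i, ξ i * (w' i + s * (x i - w' i)))
      (∑ i, (1 / w i - 1 / w' i + ηt * ξ i) * (x i - w' i)) 0 := by
    have hl : ∀ i, HasDerivAt (fun s : ℝ => w' i + s * (x i - w' i)) (x i - w' i) 0 := fun i => by
      simpa using ((hasDerivAt_id (0 : ℝ)).mul_const (x i - w' i)).const_add (w' i)
    have h1 : ∀ i, HasDerivAt (fun s : ℝ => (w' i + s * (x i - w' i)) / w i - 1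
      - Real.log ((w' i + s * (x i - w' i)) / w i))
        ((x i - w' i) / w i - (x i - w' i) / w i / ((w' i + 0 * (x i - w' i)) / w i)) 0 := fun i =>
      (((hl i).div_const (w i)).sub_const 1).sub (((hl i).div_const (w i)).log
        (by simpa using ⟨(hw'.1 i).ne', (hw.1 i).ne'⟩))
    have h2 := (HasDerivAt.fun_sum (u := Finset.univ) fun i _ => h1 i).add
      ((HasDerivAt.fun_sum (u := Finset.univ) fun i _ => (hl i).const_mul (ξ i)).const_mul ηt)
    refine h2.congr_deriv ?_
    rw [Finset.mul_sum, ← Finset.sum_add_distrib]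
    refine Finset.sum_congr rfl fun i _ => ?_
    have := (hw.1 i).ne'
    have := (hw'.1 i).ne'
    rw [zero_mul, add_zero]
    field_simp
  have hslope := hasDerivWithinAt_iff_tendsto_slope.1 (hderiv.hasDerivWithinAt (s := Set.Ioi 0))
  rw [Set.sdiff_singleton_eq_self (by simp)] at hslope
  refine ge_of_tendsto hslope ?_
  have hpos : ∀ᶠ s : ℝ in nhdsWithin 0 (Set.Ioi 0), s ∈ Set.Ioc (0 : ℝ) 1 :=
    Ioc_mem_nhdsGT one_pos
  filter_upwards [hpos] with s hs
  rw [slope_def_field]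
  refine div_nonneg (sub_nonneg.2 ?_) (by linarith [hs.1])
  have hmem : (fun i => w' i + s * (x i - w' i)) ∈ posSimplex I := by
    have := posSimplex_convex hw' hx (a := 1 - s) (b := s) (by linarith [hs.2]) hs.1.le (by ring)
    convert this using 1
    ext i
    simp only [Pi.add_apply, Pi.smul_apply, smul_eq_mul]; ring
  have h3 := hmin hmem
  simp only [Set.mem_ofPred_eq] at h3
  rw [bregman_logBarrier hw'.1 hw.1, bregman_logBarrier hmem.1 hw.1] at h3
  simpa [logDiv] using h3

/-- The regret bound for one mirror step with the log-barrier. -/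
theorem IsMirrorStep.logDiv_le {ηt : ℝ} {ξ w w' x : I → ℝ} (hw : w ∈ posSimplex I)
    (h : IsMirrorStep ηt ξ w w') (hx : x ∈ posSimplex I)
    (hg : ∀ i, -(1 / 2) ≤ ηt * (w i * ξ i)) :
    logDiv x w' ≤ logDiv x w + ηt * ∑ i, ξ i * (x i - w i)
      + 2 * ∑ i, (ηt * (w i * ξ i)) ^ 2 := by
  have hfo := h.first_order hw hx
  have hw' := h.1
  -- The optimality term is nonnegative in total, so it may be added for free; then the bound splits
  -- over coordinates. Each one follows from `log (w'/w * (1 + g)) ≤ w'/w * (1 + g) - 1` and `log (1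
  -- + g) ≥ g - 2 g²`.
  have key : ∀ i, (x i / w' i - 1 - Real.log (x i / w' i))
      + (1 / w i - 1 / w' i + ηt * ξ i) * (x i - w' i) ≤
      (x i / w i - 1 - Real.log (x i / w i)) + ηt * (ξ i * (x i - w i))
        + 2 * (ηt * (w i * ξ i)) ^ 2 := by
    intro i
    have a := hw.1 i
    have b := hw'.1 i
    have c := hx.1 i
    set g := ηt * (w i * ξ i) with hgdef
    have hg1 : 0 < 1 + g := by linarith [hg i]
    have h1 := sub_two_mul_sq_le_log_one_add (hg i)
    rw [← hgdef] at h1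
    have h2 := Real.log_le_sub_one_of_pos (mul_pos (div_pos b a) hg1)
    rw [Real.log_mul (div_pos b a).ne' hg1.ne', Real.log_div b.ne' a.ne'] at h2
    rw [Real.log_div c.ne' a.ne', Real.log_div c.ne' b.ne']
    have e1 : (1 / w i - 1 / w' i + ηt * ξ i) * (x i - w' i)
        = x i / w i - x i / w' i + 1 - w' i / w i + ηt * (ξ i * (x i - w i))
          + g * (1 - w' i / w i) := by
      rw [hgdef]; field_simp; ring
    rw [e1]
    nlinarith
  have hs := Finset.sum_le_sum fun i (_ : i ∈ Finset.univ) => key i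
  simp only [Finset.sum_add_distrib, ← Finset.mul_sum] at hs
  unfold logDiv
  linarith

end LogBarrier

/-! ### Cost vectors against an opponent's policy. -/

section Cost

variable {I J : Type*}

/-- The loss matrix of the opponent, with losses `1 - ℓ`. -/
def coLoss (M : I → J → ℝ) (j : J) (i : I) : ℝ := 1 - M i j

theorem coLoss_mem {M : I → J → ℝ} (hM : ∀ i j, M i j ∈ Set.Icc (0 : ℝ) 1) (j : J) (i : I) :
    coLoss M j i ∈ Set.Icc (0 : ℝ) 1 := by
  have := hM i j
  exact ⟨by unfold coLoss; linarith [this.2], by unfold coLoss; linarith [this.1]⟩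

variable [Fintype J]

/-- The cost vector of a player whose opponent plays `q`. -/
def cost (M : I → J → ℝ) (q : J → ℝ) (i : I) : ℝ := ∑ j, q j * M i j

theorem abs_cost_le {M : I → J → ℝ} (hM : ∀ i j, M i j ∈ Set.Icc (0 : ℝ) 1) (q : J → ℝ) (i : I) :
    |cost M q i| ≤ ∑ j, |q j| := by
  refine (Finset.abs_sum_le_sum_abs _ _).trans (Finset.sum_le_sum fun j _ => ?_)
  rw [abs_mul, abs_of_nonneg (hM i j).1]
  exact mul_le_of_le_one_right (abs_nonneg _) (hM i j).2

theorem cost_sub (M : I → J → ℝ) (q q' : J → ℝ) (i : I) :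
    cost M (fun j => q j - q' j) i = cost M q i - cost M q' i := by
  simp [cost, sub_mul]

theorem cost_mem {M : I → J → ℝ} (hM : ∀ i j, M i j ∈ Set.Icc (0 : ℝ) 1) {q : J → ℝ}
    (hq : q ∈ posSimplex J) (i : I) : cost M q i ∈ Set.Icc (0 : ℝ) 1 := by
  constructor
  · exact Finset.sum_nonneg fun j _ => mul_nonneg (hq.1 j).le (hM i j).1
  · rw [← hq.2]
    exact Finset.sum_le_sum fun j _ => mul_le_of_le_one_right (hq.1 j).le (hM i j).2

end Cost

/-! ### Residuals and the invariant ball of the Euler scheme. -/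

section Shadow

variable {I J : Type*} [Fintype I] [Fintype J]

/-- The multiplier that makes `kktResidual` orthogonal to the policy. -/
def multiplier (τ : ℝ) (F x : I → ℝ) : ℝ := (τ - ∑ i, x i ^ 2 * F i) / ∑ i, x i ^ 2

/-- The relative violation of the optimality condition of `⟨F, x⟩ + τ Ψ(x)` on the simplex. -/
def kktResidual (τ : ℝ) (F x : I → ℝ) (i : I) : ℝ := x i * (F i + multiplier τ F x) / τ - 1

/-- An explicit Euler step of the mirror flow of the log-barrier. -/
def eulerStep (h : ℝ) (u x : I → ℝ) (i : I) : ℝ := x i * (1 - h * u i)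

theorem nonempty_of_mem_posSimplex {x : I → ℝ} (hx : x ∈ posSimplex I) : Nonempty I := by
  by_contra hI
  rw [not_nonempty_iff] at hI
  simpa using hx.2

theorem sum_sq_pos_of_mem_posSimplex {x : I → ℝ} (hx : x ∈ posSimplex I) :
    0 < ∑ i, x i ^ 2 :=
  have := nonempty_of_mem_posSimplex hx
  Finset.sum_pos (fun i _ => pow_pos (hx.1 i) 2) Finset.univ_nonempty

/-- This orthogonality keeps Euler steps on the simplex, makes `multiplier` optimal, and makes the
directions `x i * u i` tangent to the simplex, as the skewness identity requires. -/
theorem sum_mul_residual {τ : ℝ} (hτ : 0 < τ) (F : I → ℝ) {x : I → ℝ} (hx : x ∈ posSimplex I) :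
    ∑ i, x i * kktResidual τ F x i = 0 := by
  have h1 : ∀ i, x i * kktResidual τ F x i
      = (x i ^ 2 * F i + x i ^ 2 * multiplier τ F x) / τ - x i := fun i => by
    unfold kktResidual; ring
  have h2 := (sum_sq_pos_of_mem_posSimplex hx).ne'
  simp only [h1, Finset.sum_sub_distrib, ← Finset.sum_div, Finset.sum_add_distrib,
    ← Finset.sum_mul, hx.2]
  unfold multiplier
  field_simp
  ring

theorem mul_add_multiplier {τ : ℝ} (hτ : 0 < τ) (F x : I → ℝ) (i : I) :
    x i * (F i + multiplier τ F x) = τ * (1 + kktResidual τ F x i) := by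
  unfold kktResidual
  field_simp
  ring

/-- The multiplier minimizes the norm of the residual. -/
theorem sum_residual_sq_le {τ : ℝ} (hτ : 0 < τ) (F : I → ℝ) {x : I → ℝ} (hx : x ∈ posSimplex I)
    (c : ℝ) : ∑ i, kktResidual τ F x i ^ 2 ≤ ∑ i, (x i * (F i + c) / τ - 1) ^ 2 := by
  -- Another multiplier shifts the residual by `x i * d`, which is orthogonal to it, so Pythagoras
  -- applies.
  set d := (c - multiplier τ F x) / τ
  have h1 : ∀ i, (x i * (F i + c) / τ - 1) ^ 2
      = kktResidual τ F x i ^ 2 + 2 * d * (x i * kktResidual τ F x i) + (x i * d) ^ 2 := fun i => by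
    have : x i * (F i + c) / τ - 1 = kktResidual τ F x i + x i * d := by
      simp only [kktResidual, d]; field_simp; ring
    rw [this]; ring
  simp only [h1, Finset.sum_add_distrib, ← Finset.mul_sum, sum_mul_residual hτ F hx]
  have : 0 ≤ ∑ i, (x i * d) ^ 2 := Finset.sum_nonneg fun i _ => sq_nonneg _
  linarith

theorem eulerStep_mem {τ h : ℝ} (hτ : 0 < τ) (F : I → ℝ) {x : I → ℝ} (hx : x ∈ posSimplex I)
    (hu : ∀ i, h * kktResidual τ F x i < 1) : eulerStep h (kktResidual τ F x) x ∈ posSimplex I := by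
  refine ⟨fun i => mul_pos (hx.1 i) (by linarith [hu i]), ?_⟩
  have : ∀ i, eulerStep h (kktResidual τ F x) x i = x i - h * (x i * kktResidual τ F x i) := fun i => by
    unfold eulerStep; ring
  simp only [this, Finset.sum_sub_distrib, ← Finset.mul_sum, sum_mul_residual hτ F hx, hx.2]
  ring

/-- The two cost operators are skew to each other along directions of the simplex. -/
theorem sum_mul_cost_add_sum_mul_cost (M : I → J → ℝ) (p : I → ℝ) (q : J → ℝ)
    (hp : ∑ i, p i = 0) :
    ∑ i, p i * cost M q i + ∑ j, q j * cost (coLoss M) p j = 0 := by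
  have h1 : ∑ j, q j * cost (coLoss M) p j = ∑ j, ∑ i, (p i * q j - p i * (q j * M i j)) := by
    refine Finset.sum_congr rfl fun j _ => ?_
    rw [cost, Finset.mul_sum]
    exact Finset.sum_congr rfl fun i _ => by unfold coLoss; ring
  rw [h1, Finset.sum_comm]
  simp only [Finset.sum_sub_distrib, ← Finset.mul_sum, ← Finset.sum_mul, hp, zero_mul, zero_sub]
  simp only [cost]
  ring

/-- Bound on the new kktResidual, relative to the old multiplier. -/
theorem sum_residual_eulerStep_le {M : I → J → ℝ} (hM : ∀ i j, M i j ∈ Set.Icc (0 : ℝ) 1)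
    {τ τ' η h ε : ℝ} (hτ : 0 < τ) (hτ' : 0 < τ') (hη : 0 < η) (hη1 : η ≤ 1) (hh : h = η * τ)
    (hh1 : h ≤ 1 / 2) (hε : 0 < ε) (hε1 : ε ≤ 1 / 8)
    (hβ : |τ / τ' - 1| ≤ h * ε ^ 2 / 2) {x : I → ℝ} {q v : J → ℝ} (hx : x ∈ posSimplex I)
    (hq : q ∈ posSimplex J) (hv : ∀ j, |v j| ≤ ε)
    (hu : ∀ i, |kktResidual τ (cost M q) x i| ≤ ε)
    (hx' : eulerStep h (kktResidual τ (cost M q) x) x ∈ posSimplex I) :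
    ∑ i, kktResidual τ' (cost M (eulerStep h v q)) (eulerStep h (kktResidual τ (cost M q) x) x) i ^ 2
      ≤ (1 + h / 2) * ((1 - h) ^ 2 * ∑ i, kktResidual τ (cost M q) x i ^ 2
        - 2 * (1 - h) * η * ∑ i, x i * kktResidual τ (cost M q) x i * cost M (fun j => q j * v j) i
        + η ^ 2 * ε ^ 2) + 27 * h * Fintype.card I * ε ^ 4 := by
  have hh0 : 0 < h := hh ▸ mul_pos hη hτ
  -- Since the new multiplier is optimal, it may be replaced by the old one, whose motion need not
  -- be tracked.
  refine (sum_residual_sq_le hτ' _ hx' (multiplier τ (cost M q) x)).trans ?_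
  set u := kktResidual τ (cost M q) x with hu_def
  set p : I → ℝ := fun i => x i * cost M (fun j => q j * v j) i with hp
  set β := τ / τ' - 1 with hβdef
  have hcost : ∀ i, |cost M (fun j => q j * v j) i| ≤ ε := fun i => by
    refine (abs_cost_le hM _ i).trans ?_
    calc ∑ j, |q j * v j| ≤ ∑ j, q j * ε := Finset.sum_le_sum fun j _ => by
          rw [abs_mul, abs_of_pos (hq.1 j)]
          exact mul_le_mul_of_nonneg_left (hv j) (hq.1 j).le
      _ = ε := by rw [← Finset.sum_mul, hq.2, one_mul]
  have hpx : ∀ i, |p i| ≤ x i * ε := fun i => by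
    rw [hp]; simp only [abs_mul, abs_of_pos (hx.1 i)]
    exact mul_le_mul_of_nonneg_left (hcost i) (hx.1 i).le
  -- An exact expansion: a part linear in the residuals, then a part quadratic in them or
  -- proportional to the change `β` of the regularization.
  have hform : ∀ i, eulerStep h u x i * (cost M (eulerStep h v q) i + multiplier τ (cost M q) x) / τ'
      - 1 = ((1 - h) * u i - η * p i)
        + (-h * u i * (u i - η * p i) + β * ((1 - h * u i) * (1 + u i - η * p i))) := by
    intro i
    have e1 : cost M (eulerStep h v q) i = cost M q i - h * cost M (fun j => q j * v j) i := by
      simp only [cost, eulerStep, Finset.mul_sum, ← Finset.sum_sub_distrib]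
      exact Finset.sum_congr rfl fun j _ => by ring
    have e2 := mul_add_multiplier hτ (cost M q) x i
    rw [← hu_def] at e2
    have e3 : eulerStep h u x i * (cost M (eulerStep h v q) i + multiplier τ (cost M q) x)
        = (1 - h * u i) * τ * (1 + u i - η * p i) := by
      have : eulerStep h u x i * (cost M (eulerStep h v q) i + multiplier τ (cost M q) x)
        = (1 - h * u i) * (x i * (cost M q i + multiplier τ (cost M q) x) - h * p i) := by
        rw [e1, eulerStep, hp]; ring
      rw [this, e2, hh]; ring
    rw [e3, hβdef]
    field_simp
    ring
  have hterm : ∀ i, (eulerStep h u x i * (cost M (eulerStep h v q) i + multiplier τ (cost M q) x)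
      / τ' - 1) ^ 2 ≤ (1 + h / 2) * ((1 - h) ^ 2 * u i ^ 2
        - 2 * (1 - h) * η * (x i * u i * cost M (fun j => q j * v j) i) + η ^ 2 * (x i * ε ^ 2))
        + 27 * h * ε ^ 4 := by
    intro i
    rw [hform i]
    set B := -h * u i * (u i - η * p i) + β * ((1 - h * u i) * (1 + u i - η * p i)) with hB
    have hx1 := posSimplex_le_one hx i
    have hx0 := hx.1 i
    have hpε : |p i| ≤ ε := (hpx i).trans (mul_le_of_le_one_left hε.le hx1)
    have hηp : |η * p i| ≤ ε := by
      rw [abs_mul, abs_of_pos hη]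
      exact (mul_le_of_le_one_left (abs_nonneg _) hη1).trans hpε
    have hui := hu i
    have h2 : |u i - η * p i| ≤ 2 * ε := (abs_sub _ _).trans (by linarith)
    have hBle : |B| ≤ 3 * h * ε ^ 2 := by
      have b1 : |-h * u i * (u i - η * p i)| ≤ h * ε * (2 * ε) := by
        rw [abs_mul, abs_mul, abs_neg, abs_of_pos hh0]
        gcongr
      have b2 : |1 - h * u i| ≤ 17 / 16 := by
        refine (abs_sub _ _).trans ?_
        rw [abs_one, abs_mul, abs_of_pos hh0]
        have : h * |u i| ≤ 1 / 2 * (1 / 8) := by gcongr; linarith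
        linarith
      have b3 : |1 + u i - η * p i| ≤ 5 / 4 := by
        rw [add_sub_assoc]
        refine (abs_add_le _ _).trans ?_
        rw [abs_one]; linarith
      have b4 : |β * ((1 - h * u i) * (1 + u i - η * p i))| ≤ h * ε ^ 2 / 2 * (17 / 16 * (5 / 4)) := by
        rw [abs_mul, abs_mul]
        gcongr
      refine (abs_add_le _ _).trans ?_
      have : 0 < h * ε ^ 2 := by positivity
      linarith
    have hB2 : B ^ 2 ≤ (3 * h * ε ^ 2) ^ 2 := sq_le_sq' (neg_le_of_abs_le hBle) (le_of_abs_le hBle)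
    have hp2 : p i ^ 2 ≤ x i * ε ^ 2 := by
      have := pow_le_pow_left₀ (abs_nonneg _) (hpx i) 2
      rw [sq_abs, mul_pow _ ε] at this
      have hxx : x i ^ 2 ≤ x i := by
        rw [sq]; exact mul_le_of_le_one_left hx0.le hx1
      exact this.trans (by gcongr)
    set A := (1 - h) * u i - η * p i with hA
    -- Young's inequality with weight `h / 2`: the loss on the linear part stays below the gain from
    -- contraction, and the factor `2 / h` is affordable because `B = O(h ε²)`.
    have hAB : (A + B) ^ 2 ≤ (1 + h / 2) * A ^ 2 + (1 + 2 / h) * B ^ 2 := by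
      have : (1 + h / 2) * A ^ 2 + (1 + 2 / h) * B ^ 2 - (A + B) ^ 2
          = 2 / h * (h / 2 * A - B) ^ 2 := by field_simp; ring
      have : 0 ≤ 2 / h * (h / 2 * A - B) ^ 2 := by positivity
      linarith
    have hB3 : (1 + 2 / h) * B ^ 2 ≤ 27 * h * ε ^ 4 := by
      have c1 : 1 + 2 / h ≤ 3 / h := by
        rw [← sub_nonneg]
        have : 3 / h - (1 + 2 / h) = (1 - h) / h := by field_simp; ring
        rw [this]; exact div_nonneg (by linarith) hh0.le
      calc (1 + 2 / h) * B ^ 2 ≤ 3 / h * (3 * h * ε ^ 2) ^ 2 := by gcongr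
        _ = 27 * h * ε ^ 4 := by field_simp; ring
    have hA2 : A ^ 2 ≤ (1 - h) ^ 2 * u i ^ 2
        - 2 * (1 - h) * η * (x i * u i * cost M (fun j => q j * v j) i) + η ^ 2 * (x i * ε ^ 2) := by
      have : A ^ 2 = (1 - h) ^ 2 * u i ^ 2
        - 2 * (1 - h) * η * (x i * u i * cost M (fun j => q j * v j) i) + η ^ 2 * p i ^ 2 := by
        rw [hA, hp]; ring
      rw [this]
      gcongr
    have : (1 + h / 2) * A ^ 2 ≤ _ := mul_le_mul_of_nonneg_left hA2 (by positivity)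
    linarith
  refine (Finset.sum_le_sum fun i _ => hterm i).trans (le_of_eq ?_)
  simp only [Finset.sum_add_distrib, Finset.sum_sub_distrib, ← Finset.mul_sum, ← Finset.sum_mul,
    hx.2, Finset.sum_const, Finset.card_univ, nsmul_eq_mul]
  ring

theorem abs_le_of_sum_sq_le {u : I → ℝ} {ε : ℝ} (hε : 0 ≤ ε) (h : ∑ i, u i ^ 2 ≤ ε ^ 2) (i : I) :
    |u i| ≤ ε :=
  abs_le_of_sq_le_sq ((Finset.single_le_sum (f := fun i => u i ^ 2) (fun _ _ => sq_nonneg _)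
    (Finset.mem_univ i)).trans h) hε

/-- The residual of the joint Euler step stays in the same ball. -/
theorem residual_ball_invariant {M : I → J → ℝ} (hM : ∀ i j, M i j ∈ Set.Icc (0 : ℝ) 1)
    {τ τ' η h ε : ℝ} (hτ : 0 < τ) (hτ' : 0 < τ') (hη : 0 < η) (hη1 : η ≤ 1) (hh : h = η * τ)
    (hh1 : h ≤ 1 / 2) (hητ : 4 * η ≤ τ) (hε : 0 < ε) (hε1 : ε ≤ 1 / 8)
    (hK : 64 * ((Fintype.card I : ℝ) + Fintype.card J) * ε ^ 2 ≤ 1)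
    (hβ : |τ / τ' - 1| ≤ h * ε ^ 2 / 2) {x : I → ℝ} {q : J → ℝ} (hx : x ∈ posSimplex I)
    (hq : q ∈ posSimplex J)
    (hE : ∑ i, kktResidual τ (cost M q) x i ^ 2 + ∑ j, kktResidual τ (cost (coLoss M) x) q j ^ 2 ≤ ε ^ 2) :
    eulerStep h (kktResidual τ (cost M q) x) x ∈ posSimplex I ∧
    eulerStep h (kktResidual τ (cost (coLoss M) x) q) q ∈ posSimplex J ∧
    ∑ i, kktResidual τ' (cost M (eulerStep h (kktResidual τ (cost (coLoss M) x) q) q))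
        (eulerStep h (kktResidual τ (cost M q) x) x) i ^ 2
      + ∑ j, kktResidual τ' (cost (coLoss M) (eulerStep h (kktResidual τ (cost M q) x) x))
        (eulerStep h (kktResidual τ (cost (coLoss M) x) q) q) j ^ 2 ≤ ε ^ 2 := by
  have hh0 : 0 < h := hh ▸ mul_pos hη hτ
  set u := kktResidual τ (cost M q) x with hu_def
  set v := kktResidual τ (cost (coLoss M) x) q with hv_def
  have hu : ∀ i, |u i| ≤ ε := abs_le_of_sum_sq_le hε.le
    (le_trans (le_add_of_nonneg_right (Finset.sum_nonneg fun j _ => sq_nonneg _)) hE)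
  have hv : ∀ i, |v i| ≤ ε := abs_le_of_sum_sq_le hε.le
    (le_trans (le_add_of_nonneg_left (Finset.sum_nonneg fun j _ => sq_nonneg _)) hE)
  have hsmall : ∀ r : ℝ, |r| ≤ ε → h * r < 1 := fun r hr => by
    have := mul_le_mul_of_nonneg_left ((le_of_abs_le hr).trans hε1) hh0.le
    linarith
  have hx' : eulerStep h u x ∈ posSimplex I := eulerStep_mem hτ _ hx fun _ => hsmall _ (hu _)
  have hq' : eulerStep h v q ∈ posSimplex J := eulerStep_mem hτ _ hq fun _ => hsmall _ (hv _)
  refine ⟨hx', hq', ?_⟩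
  have b1 := sum_residual_eulerStep_le hM hτ hτ' hη hη1 hh hh1 hε hε1 hβ hx hq hv hu hx'
  have b2 := sum_residual_eulerStep_le (coLoss_mem hM) hτ hτ' hη hη1 hh hh1 hε hε1 hβ hq hx hu hv hq'
  rw [← hu_def] at b1
  rw [← hv_def] at b2
  -- The cross terms of the two players are of order `η ε²`, not bounded by the contraction; they
  -- cancel exactly.
  have hskew := sum_mul_cost_add_sum_mul_cost M (fun i => x i * u i) (fun j => q j * v j)
    (sum_mul_residual hτ _ hx)
  refine (add_le_add b1 b2).trans ?_
  set E := ∑ i, u i ^ 2 + ∑ j, v j ^ 2 with hE_def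
  have e : (1 + h / 2) * ((1 - h) ^ 2 * ∑ i, u i ^ 2
        - 2 * (1 - h) * η * ∑ i, x i * u i * cost M (fun j => q j * v j) i
        + η ^ 2 * ε ^ 2) + 27 * h * Fintype.card I * ε ^ 4 +
      ((1 + h / 2) * ((1 - h) ^ 2 * ∑ j, v j ^ 2
        - 2 * (1 - h) * η * ∑ j, q j * v j * cost (coLoss M) (fun i => x i * u i) j
        + η ^ 2 * ε ^ 2) + 27 * h * Fintype.card J * ε ^ 4)
      = (1 + h / 2) * ((1 - h) ^ 2 * E + 2 * η ^ 2 * ε ^ 2)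
        + 27 / 64 * h * ε ^ 2 * (64 * ((Fintype.card I : ℝ) + Fintype.card J) * ε ^ 2) := by
    rw [hE_def]
    linear_combination (-(1 + h / 2) * 2 * (1 - h) * η) * hskew
  rw [e]
  have hη2 : 2 * η ^ 2 ≤ h / 2 := by
    have := mul_le_mul_of_nonneg_left hητ hη.le
    rw [hh]; linarith
  have c1 : (1 - h) ^ 2 * E + 2 * η ^ 2 * ε ^ 2 ≤ ((1 - h) ^ 2 + h / 2) * ε ^ 2 := by
    rw [add_mul]; gcongr
  have c2 : (1 + h / 2) * ((1 - h) ^ 2 * E + 2 * η ^ 2 * ε ^ 2)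
      ≤ (1 + h / 2) * (((1 - h) ^ 2 + h / 2) * ε ^ 2) :=
    mul_le_mul_of_nonneg_left c1 (by positivity)
  have c3 : 27 / 64 * h * ε ^ 2 * (64 * ((Fintype.card I : ℝ) + Fintype.card J) * ε ^ 2)
      ≤ 27 / 64 * h * ε ^ 2 := mul_le_of_le_one_right (by positivity) hK
  have c4 : (1 + h / 2) * ((1 - h) ^ 2 + h / 2) + 27 / 64 * h ≤ 1 := by
    have d1 : h * h ≤ h * (1 / 2) := mul_le_mul_of_nonneg_left hh1 hh0.le
    have d2 : h * (h * h) ≤ h * (h * (1 / 2)) := mul_le_mul_of_nonneg_left d1 hh0.le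
    linarith
  have c5 : ((1 + h / 2) * ((1 - h) ^ 2 + h / 2) + 27 / 64 * h) * ε ^ 2 ≤ 1 * ε ^ 2 :=
    mul_le_mul_of_nonneg_right c4 (sq_nonneg _)
  linarith

theorem uniform_mem_posSimplex [Nonempty I] :
    (fun _ : I => 1 / (Fintype.card I : ℝ)) ∈ posSimplex I := by
  refine ⟨fun i => by positivity, ?_⟩
  simp

/-- With multiplier `m τ`, where `m` is the number of actions, the uniform policy violates
optimality only by `F i / (m τ)`. -/
theorem sum_residual_uniform_le [Nonempty I] {τ : ℝ} (hτ : 0 < τ) {F : I → ℝ}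
    (hF : ∀ i, F i ∈ Set.Icc (0 : ℝ) 1) :
    ∑ i, kktResidual τ F (fun _ : I => 1 / (Fintype.card I : ℝ)) i ^ 2 ≤ 1 / τ ^ 2 := by
  have hm : (1 : ℝ) ≤ Fintype.card I := by exact_mod_cast Fintype.card_pos
  refine (sum_residual_sq_le hτ F uniform_mem_posSimplex (Fintype.card I * τ)).trans ?_
  have h1 : ∀ i, (1 / (Fintype.card I : ℝ) * (F i + Fintype.card I * τ) / τ - 1) ^ 2
      ≤ 1 / τ ^ 2 / Fintype.card I := fun i => by
    have e : (1 / (Fintype.card I : ℝ) * (F i + Fintype.card I * τ) / τ - 1) ^ 2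
      = F i ^ 2 / τ ^ 2 / (Fintype.card I : ℝ) ^ 2 := by field_simp; ring
    rw [e]
    have := hF i
    gcongr
    · exact pow_le_one₀ this.1 this.2
    · exact le_self_pow₀ hm two_ne_zero
  refine (Finset.sum_le_sum fun i _ => h1 i).trans (le_of_eq ?_)
  rw [Finset.sum_const, Finset.card_univ, nsmul_eq_mul]
  field_simp

/-- A policy with small residual is nearly a best response. -/
theorem sum_mul_sub_le_of_residual {τ ε : ℝ} (hτ : 0 < τ) (hε1 : ε ≤ 1) (F : I → ℝ) {x : I → ℝ}
    (hx : x ∈ posSimplex I) (hu : ∀ i, |kktResidual τ F x i| ≤ ε) (i : I) :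
    ∑ k, x k * F k - F i ≤ τ * (Fintype.card I * (1 + ε)) := by
  -- The optimality relation makes `F i + λ` nonnegative, while averaging it under `x` gives `τ ∑ (1
  -- + u k)`; subtracting eliminates `λ`.
  have h1 : -multiplier τ F x ≤ F i := by
    have := mul_add_multiplier hτ F x i
    have h2 : 0 ≤ τ * (1 + kktResidual τ F x i) :=
      mul_nonneg hτ.le (by linarith [neg_le_of_abs_le (hu i)])
    rw [← this] at h2
    linarith [nonneg_of_mul_nonneg_right h2 (hx.1 i)]
  have h2 : ∑ k, x k * F k + multiplier τ F x = τ * ∑ k, (1 + kktResidual τ F x k) := by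
    rw [Finset.mul_sum, ← Finset.sum_congr rfl fun k _ => mul_add_multiplier hτ F x k]
    simp only [mul_add, Finset.sum_add_distrib, ← Finset.sum_mul, hx.2, one_mul]
  have h3 : ∑ k, (1 + kktResidual τ F x k) ≤ ∑ _k : I, (1 + ε) :=
    Finset.sum_le_sum fun k _ => by linarith [le_of_abs_le (hu k)]
  rw [Finset.sum_const, Finset.card_univ, nsmul_eq_mul] at h3
  have := mul_le_mul_of_nonneg_left h3 hτ.le
  linarith

end Shadow

/-! ### One-step drift of the divergence to the reference path. -/

section Drift

variable {I J : Type*} [Fintype I] [Fintype J]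

theorem logDiv_eulerStep_le {h : ℝ} {u x y : I → ℝ} (hx : ∀ i, 0 < x i) (hy : ∀ i, 0 < y i)
    (hu : ∀ i, h * u i ≤ 1 / 2) :
    logDiv (eulerStep h u x) y
      ≤ logDiv x y + ∑ i, (h * (u i * (1 - x i / y i)) + 2 * (h * u i) ^ 2) := by
  unfold logDiv
  rw [← Finset.sum_add_distrib]
  refine Finset.sum_le_sum fun i _ => ?_
  have h1 := sub_two_mul_sq_le_log_one_add (g := -(h * u i)) (by linarith [hu i])
  have h2 : 0 < 1 + -(h * u i) := by linarith [hu i]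
  have e : eulerStep h u x i / y i = x i / y i * (1 + -(h * u i)) := by
    unfold eulerStep; ring
  rw [e, Real.log_mul (div_pos (hx i) (hy i)).ne' h2.ne']
  linarith

/-- One step of the regularized mirror descent, compared to a policy `x`. -/
theorem IsMirrorStep.logDiv_regularized_le [DecidableEq I] {η τ ℓ : ℝ} (hη : 0 < η)
    (hh1 : η * τ ≤ 1 / 2) (hℓ : ℓ ∈ Set.Icc (0 : ℝ) 1) {a : I}
    {w w' x : I → ℝ} (hw : w ∈ posSimplex I)
    (h : IsMirrorStep η (regularizedEstimate τ w a ℓ) w w') (hx : x ∈ posSimplex I) :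
    logDiv x w' ≤ logDiv x w + η * ((x a - w a) / w a * ℓ)
      + ∑ i, (η * τ) * (1 - x i / w i)
      + (4 * η ^ 2 + 4 * Fintype.card I * (η * τ) ^ 2) := by
  have hξ : ∀ i, regularizedEstimate τ w a ℓ i
      = (if i = a then ℓ / w i else 0) - τ / w i := fun i => by
    rw [regularizedEstimate, grad_logBarrier w hw.1, importanceEstimate]; ring
  -- Both the importance weight and the barrier gradient scale like `1 / w i`, so multiplication by
  -- `w i` leaves bounded quantities.
  have hg : ∀ i, η * (w i * regularizedEstimate τ w a ℓ i)
      = (if i = a then η * ℓ else 0) - η * τ := fun i => by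
    have := (hw.1 i).ne'
    rw [hξ]; split_ifs <;> field_simp
    simp
  have hηℓ : 0 ≤ η * ℓ := mul_nonneg hη.le hℓ.1
  have hηℓ1 : η * ℓ ≤ η := mul_le_of_le_one_right hη.le hℓ.2
  have hmain := h.logDiv_le hw hx fun i => by
    rw [hg]; split_ifs <;> linarith
  have e1 : η * ∑ i, regularizedEstimate τ w a ℓ i * (x i - w i)
      = η * ((x a - w a) / w a * ℓ) + ∑ i, (η * τ) * (1 - x i / w i) := by
    have : ∀ i, regularizedEstimate τ w a ℓ i * (x i - w i)
        = (if i = a then (x a - w a) / w a * ℓ else 0) + τ * (1 - x i / w i) := fun i => by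
      have := (hw.1 i).ne'
      rw [hξ]; split_ifs with hia
      · subst hia; field_simp; ring
      · field_simp; ring
    simp only [this, Finset.sum_add_distrib, Finset.sum_ite_eq', Finset.mem_univ, if_true,
      ← Finset.mul_sum]
    ring
  have e2 : ∑ i, (η * (w i * regularizedEstimate τ w a ℓ i)) ^ 2
      ≤ ∑ i, ((if i = a then 2 * η ^ 2 else 0) + 2 * (η * τ) ^ 2) := by
    refine Finset.sum_le_sum fun i _ => ?_
    rw [hg]
    have hsq : (η * ℓ) ^ 2 ≤ η ^ 2 := pow_le_pow_left₀ hηℓ hηℓ1 2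
    split_ifs
    · nlinarith [sq_nonneg (η * ℓ + η * τ)]
    · nlinarith [sq_nonneg (η * τ)]
  have e3 : ∑ i, ((if i = a then 2 * η ^ 2 else 0) + 2 * (η * τ) ^ 2)
      = 2 * η ^ 2 + Fintype.card I * (2 * (η * τ) ^ 2) := by
    simp [Finset.sum_add_distrib]
  rw [e1] at hmain
  rw [e3] at e2
  linarith

/-- The expected change of the divergence of one player, up to the interaction term. -/
theorem logDiv_drift_le {τ η h : ℝ} (hτ : 0 < τ) (hη : 0 < η) (hh : h = η * τ) (hh1 : h ≤ 1 / 2)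
    {F Fy x y : I → ℝ} (hx : x ∈ posSimplex I) (hy : y ∈ posSimplex I)
    (hFy : ∀ i, Fy i ∈ Set.Icc (0 : ℝ) 1) (hu : ∀ i, |kktResidual τ F x i| ≤ 1 / 8) :
    logDiv (eulerStep h (kktResidual τ F x) x) y
      + η * ∑ i, (eulerStep h (kktResidual τ F x) x i - y i) * Fy i
      + ∑ i, h * (1 - eulerStep h (kktResidual τ F x) x i / y i)
      + (4 * η ^ 2 + 4 * Fintype.card I * h ^ 2)
    ≤ (1 - h / 2) * logDiv x y + η * ∑ i, (x i - y i) * (Fy i - F i)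
      + 5 * Fintype.card I * (η ^ 2 + h ^ 2) := by
  have hh0 : 0 < h := hh ▸ mul_pos hη hτ
  set u := kktResidual τ F x with hu_def
  have h1 := logDiv_eulerStep_le (h := h) (u := u) hx.1 hy.1 fun i => by
    have := mul_le_mul_of_nonneg_left ((le_abs_self _).trans (hu i)) hh0.le
    linarith
  have hS := logDiv_le_sum_sq hx.1 hy.1
  have hterm : ∀ i, (h * (u i * (1 - x i / y i)) + 2 * (h * u i) ^ 2)
      + η * ((eulerStep h u x i - y i) * Fy i) + h * (1 - eulerStep h u x i / y i)
      ≤ η * ((x i - y i) * (Fy i - F i)) + η * multiplier τ F x * (y i - x i)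
        - h / 2 * ((x i - y i) ^ 2 / (x i * y i)) + (h ^ 2 / 2 + η * h / 8) := by
    intro i
    have hx0 := hx.1 i
    have hy0 := hy.1 i
    have hx1 := posSimplex_le_one hx i
    set S := (x i - y i) ^ 2 / (x i * y i) with hS_def
    have hS0 : 0 ≤ S := by positivity
    have hui := abs_le.1 (hu i)
    have hm := mul_add_multiplier hτ F x i
    rw [← hu_def] at hm
    have hxy : x i / y i ≤ S + 2 := by
      have : S + 2 - x i / y i = y i / x i := by rw [hS_def]; field_simp; ring
      have : 0 < y i / x i := div_pos hy0 hx0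
      linarith
    have hxy0 : 0 < x i / y i := div_pos hx0 hy0
    -- The near-optimality of `x` converts the barrier term into a cost term plus `-h (1 + u i) S`,
    -- the source of the contraction. A residual of at most `1 / 8` leaves enough of it for the
    -- factor `h / 2` after the second-order errors.
    have e1 : h * (1 + u i) * (1 - x i / y i)
        = η * (F i + multiplier τ F x) * (y i - x i) - h * (1 + u i) * S := by
      have a1 : h * (1 + u i) = η * (x i * (F i + multiplier τ F x)) := by rw [hm, hh]; ring
      rw [a1, hS_def]; field_simp; ring
    have e2 : (h * (u i * (1 - x i / y i)) + 2 * (h * u i) ^ 2)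
      + η * ((eulerStep h u x i - y i) * Fy i) + h * (1 - eulerStep h u x i / y i)
      = h * (1 + u i) * (1 - x i / y i) + h ^ 2 * (u i * (x i / y i)) + 2 * h ^ 2 * u i ^ 2
        + η * ((x i - y i) * Fy i) + η * h * (-(x i * u i * Fy i)) := by
      unfold eulerStep; ring
    rw [e2, e1]
    have b1 : h ^ 2 * (u i * (x i / y i)) ≤ h ^ 2 * (1 / 8 * (S + 2)) := by
      refine mul_le_mul_of_nonneg_left ?_ (sq_nonneg h)
      exact mul_le_mul hui.2 hxy hxy0.le (by norm_num)
    have b2 : u i ^ 2 ≤ (1 / 8) ^ 2 := sq_le_sq' hui.1 hui.2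
    have b3 : -(x i * u i * Fy i) ≤ 1 / 8 := by
      refine (neg_le_abs _).trans ?_
      rw [abs_mul, abs_mul, abs_of_pos hx0, abs_of_nonneg (hFy i).1]
      calc x i * |u i| * Fy i ≤ 1 * (1 / 8) * 1 := by
            gcongr
            · exact (hFy i).1
            · exact hu i
            · exact (hFy i).2
        _ = 1 / 8 := by norm_num
    have b4 : h * (7 / 8) * S ≤ h * (1 + u i) * S := by
      refine mul_le_mul_of_nonneg_right ?_ hS0
      exact mul_le_mul_of_nonneg_left (by linarith) hh0.le
    have b5 : h ^ 2 * (1 / 8 * S) ≤ h / 2 * (1 / 8 * S) := by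
      refine mul_le_mul_of_nonneg_right ?_ (by positivity)
      rw [sq]
      have := mul_le_mul_of_nonneg_left hh1 hh0.le
      linarith
    have b6 : 2 * h ^ 2 * u i ^ 2 ≤ 2 * h ^ 2 * (1 / 8) ^ 2 :=
      mul_le_mul_of_nonneg_left b2 (by positivity)
    have b7 : η * h * (-(x i * u i * Fy i)) ≤ η * h * (1 / 8) :=
      mul_le_mul_of_nonneg_left b3 (by positivity)
    have b8 : 0 ≤ h * S := mul_nonneg hh0.le hS0
    have b9 : 0 ≤ h ^ 2 := sq_nonneg h
    linarith
  have hsum := Finset.sum_le_sum fun i (_ : i ∈ Finset.univ) => hterm i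
  have hxy : ∑ i, (y i - x i) = 0 := by simp [hx.2, hy.2]
  simp only [Finset.sum_add_distrib, Finset.sum_sub_distrib, ← Finset.mul_sum, Finset.sum_const,
    Finset.card_univ, nsmul_eq_mul] at hsum h1 hxy ⊢
  have hS2 := mul_le_mul_of_nonneg_left hS (by positivity : 0 ≤ h / 2)
  have hm : (1 : ℝ) ≤ Fintype.card I := by
    have := nonempty_of_mem_posSimplex hx
    exact_mod_cast Fintype.card_pos
  have hηh : η * h ≤ (η ^ 2 + h ^ 2) / 2 := by nlinarith [sq_nonneg (η - h)]
  have hc1 : (Fintype.card I : ℝ) * (η * h) ≤ Fintype.card I * ((η ^ 2 + h ^ 2) / 2) := by gcongr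
  have hc2 : 1 * η ^ 2 ≤ (Fintype.card I : ℝ) * η ^ 2 := by gcongr
  have hη2 := sq_nonneg η
  have hc3 : 0 ≤ (Fintype.card I : ℝ) * h ^ 2 := by positivity
  -- The multiplier disappears because both policies have total mass one.
  have hc4 : η * multiplier τ F x * (∑ i, y i - ∑ i, x i) = 0 := by rw [hxy, mul_zero]
  linarith

/-- The expected change of the divergence of both players. -/
theorem logDiv_joint_drift_le {M : I → J → ℝ} (hM : ∀ i j, M i j ∈ Set.Icc (0 : ℝ) 1)
    {τ η h : ℝ} (hτ : 0 < τ) (hη : 0 < η) (hh : h = η * τ) (hh1 : h ≤ 1 / 2)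
    {x y : I → ℝ} {q z : J → ℝ} (hx : x ∈ posSimplex I) (hy : y ∈ posSimplex I)
    (hq : q ∈ posSimplex J) (hz : z ∈ posSimplex J)
    (hu : ∀ i, |kktResidual τ (cost M q) x i| ≤ 1 / 8)
    (hv : ∀ j, |kktResidual τ (cost (coLoss M) x) q j| ≤ 1 / 8) :
    (logDiv (eulerStep h (kktResidual τ (cost M q) x) x) y
      + η * ∑ i, (eulerStep h (kktResidual τ (cost M q) x) x i - y i) * cost M z i
      + ∑ i, h * (1 - eulerStep h (kktResidual τ (cost M q) x) x i / y i)
      + (4 * η ^ 2 + 4 * Fintype.card I * h ^ 2))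
    + (logDiv (eulerStep h (kktResidual τ (cost (coLoss M) x) q) q) z
      + η * ∑ j, (eulerStep h (kktResidual τ (cost (coLoss M) x) q) q j - z j)
        * cost (coLoss M) y j
      + ∑ j, h * (1 - eulerStep h (kktResidual τ (cost (coLoss M) x) q) q j / z j)
      + (4 * η ^ 2 + 4 * Fintype.card J * h ^ 2))
    ≤ (1 - h / 2) * (logDiv x y + logDiv q z)
      + 5 * ((Fintype.card I : ℝ) + Fintype.card J) * (η ^ 2 + h ^ 2) := by
  have h1 := logDiv_drift_le hτ hη hh hh1 hx hy (cost_mem hM hz) hu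
  have h2 := logDiv_drift_le hτ hη hh hh1 hq hz (cost_mem (coLoss_mem hM) hy) hv
  -- The costs in the two drifts differ by the opponent's displacement, so the interaction is again
  -- a skew form evaluated on the displacements.
  have hskew := sum_mul_cost_add_sum_mul_cost M (fun i => x i - y i) (fun j => q j - z j)
    (by simp [hx.2, hy.2])
  have e1 : ∑ i, (x i - y i) * (cost M z i - cost M q i)
      = -∑ i, (x i - y i) * cost M (fun j => q j - z j) i := by
    rw [← Finset.sum_neg_distrib]
    exact Finset.sum_congr rfl fun i _ => by rw [cost_sub]; ring
  have e2 : ∑ j, (q j - z j) * (cost (coLoss M) y j - cost (coLoss M) x j)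
      = -∑ j, (q j - z j) * cost (coLoss M) (fun i => x i - y i) j := by
    rw [← Finset.sum_neg_distrib]
    exact Finset.sum_congr rfl fun i _ => by rw [cost_sub]; ring
  rw [e1] at h1
  rw [e2] at h2
  refine (add_le_add h1 h2).trans (le_of_eq ?_)
  linear_combination (-η) * hskew

end Drift

/-! ### Schedule requirements and the reference path. -/

section Schedule

/-- The properties of the learning rates `η`, of the regularization strengths `τ` and of the
tolerance `ε` on the residual of the reference path that make the analysis work. -/
structure GoodSchedule (K : ℕ) (δ ε : ℝ) (η τ : ℕ → ℝ) : Prop where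
  eps_pos : 0 < ε
  eps_le : ε ≤ 1 / 8
  card_mul_le : 64 * (K : ℝ) * ε ^ 2 ≤ 1
  eta_pos : ∀ t, 0 < η t
  eta_le : ∀ t, η t ≤ 1
  tau_pos : ∀ t, 0 < τ t
  mul_le : ∀ t, η t * τ t ≤ 1 / 2
  four_mul_le : ∀ t, 4 * η t ≤ τ t
  abs_ratio_sub_le : ∀ t, |τ t / τ (t + 1) - 1| ≤ η t * τ t * ε ^ 2 / 2
  init_le : 2 / τ 0 ^ 2 ≤ ε ^ 2
  contraction : ∀ t, (1 - η t * τ t / 2) * τ t ^ 2 ≤ τ (t + 1) ^ 2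
  budget : ∀ n, ∑ t ∈ Finset.range n,
    80 * K * (η t ^ 2 + (η t * τ t) ^ 2) / τ (t + 1) ^ 2 ≤ δ

variable {I J : Type*} [Fintype I] [Fintype J]

/-- The deterministic reference path: the explicit Euler scheme, started at the uniform policies,
for the mirror flow of the regularized game with exact feedback. -/
def shadow (M : I → J → ℝ) (η τ : ℕ → ℝ) : ℕ → (I → ℝ) × (J → ℝ)
  | 0 => (fun _ => 1 / (Fintype.card I : ℝ), fun _ => 1 / (Fintype.card J : ℝ))
  | t + 1 =>
    (eulerStep (η t * τ t) (kktResidual (τ t) (cost M (shadow M η τ t).2) (shadow M η τ t).1)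
      (shadow M η τ t).1,
    eulerStep (η t * τ t)
      (kktResidual (τ t) (cost (coLoss M) (shadow M η τ t).1) (shadow M η τ t).2)
      (shadow M η τ t).2)

variable [Nonempty I] [Nonempty J] {M : I → J → ℝ} {K : ℕ} {δ ε : ℝ} {η τ : ℕ → ℝ}

theorem GoodSchedule.shadow_invariant (hS : GoodSchedule K δ ε η τ)
    (hK : Fintype.card I + Fintype.card J = K) (hM : ∀ i j, M i j ∈ Set.Icc (0 : ℝ) 1) (t : ℕ) :
    (shadow M η τ t).1 ∈ posSimplex I ∧ (shadow M η τ t).2 ∈ posSimplex J ∧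
    ∑ i, kktResidual (τ t) (cost M (shadow M η τ t).2) (shadow M η τ t).1 i ^ 2
      + ∑ j, kktResidual (τ t) (cost (coLoss M) (shadow M η τ t).1) (shadow M η τ t).2 j ^ 2
      ≤ ε ^ 2 := by
  induction t with
  | zero =>
    refine ⟨uniform_mem_posSimplex, uniform_mem_posSimplex, ?_⟩
    have h1 := sum_residual_uniform_le (I := I) (hS.tau_pos 0)
      (cost_mem hM (uniform_mem_posSimplex (I := J)))
    have h2 := sum_residual_uniform_le (I := J) (hS.tau_pos 0)
      (cost_mem (coLoss_mem hM) (uniform_mem_posSimplex (I := I)))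
    refine (add_le_add h1 h2).trans (le_trans (le_of_eq ?_) hS.init_le)
    ring
  | succ t ih =>
    refine residual_ball_invariant hM (hS.tau_pos t) (hS.tau_pos (t + 1)) (hS.eta_pos t)
      (hS.eta_le t) rfl (hS.mul_le t) (hS.four_mul_le t) hS.eps_pos hS.eps_le ?_
      (hS.abs_ratio_sub_le t) ih.1 ih.2.1 ih.2.2
    rw [← Nat.cast_add, hK]
    exact hS.card_mul_le

theorem GoodSchedule.abs_residual_fst_le (hS : GoodSchedule K δ ε η τ)
    (hK : Fintype.card I + Fintype.card J = K) (hM : ∀ i j, M i j ∈ Set.Icc (0 : ℝ) 1) (t : ℕ)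
    (i : I) :
    |kktResidual (τ t) (cost M (shadow M η τ t).2) (shadow M η τ t).1 i| ≤ 1 / 8 :=
  (abs_le_of_sum_sq_le hS.eps_pos.le ((le_add_of_nonneg_right
    (Finset.sum_nonneg fun _ _ => sq_nonneg _)).trans (hS.shadow_invariant hK hM t).2.2) i).trans
    hS.eps_le

theorem GoodSchedule.abs_residual_snd_le (hS : GoodSchedule K δ ε η τ)
    (hK : Fintype.card I + Fintype.card J = K) (hM : ∀ i j, M i j ∈ Set.Icc (0 : ℝ) 1) (t : ℕ)
    (j : J) :
    |kktResidual (τ t) (cost (coLoss M) (shadow M η τ t).1) (shadow M η τ t).2 j| ≤ 1 / 8 :=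
  (abs_le_of_sum_sq_le hS.eps_pos.le ((le_add_of_nonneg_left
    (Finset.sum_nonneg fun _ _ => sq_nonneg _)).trans (hS.shadow_invariant hK hM t).2.2) j).trans
    hS.eps_le

end Schedule

/-! ### From closeness to the path to the exploitability gap. -/

section Exploitability

variable {A B : Type*}

theorem MatrixGame.meanLoss_mem (G : MatrixGame A B) (a : A) (b : B) :
    G.meanLoss a b ∈ Set.Icc (0 : ℝ) 1 := by
  constructor
  · exact integral_nonneg fun x => x.2.1
  · have h := integral_mono_of_nonneg (μ := (G.law a b : Measure unitInterval))
      (f := fun x => (x : ℝ)) (g := fun _ => (1 : ℝ)) (Filter.Eventually.of_forall fun x => x.2.1)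
      (integrable_const _) (Filter.Eventually.of_forall fun x => x.2.2)
    simpa [MatrixGame.meanLoss] using h

variable [Fintype A] [Fintype B]

theorem MatrixGame.expectedLoss_eq (G : MatrixGame A B) (μ : A → ℝ) (ν : B → ℝ) :
    G.expectedLoss μ ν = ∑ a, μ a * cost G.meanLoss ν a := by
  simp only [MatrixGame.expectedLoss, cost, Finset.mul_sum, mul_assoc]

theorem MatrixGame.expectedLoss_eq_one_sub (G : MatrixGame A B) {μ : A → ℝ} {ν : B → ℝ}
    (hμ : ∑ a, μ a = 1) (hν : ∑ b, ν b = 1) :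
    G.expectedLoss μ ν = 1 - ∑ b, ν b * cost (coLoss G.meanLoss) μ b := by
  have h1 : ∀ b, ν b * cost (coLoss G.meanLoss) μ b
      = ν b * ∑ a, μ a - ∑ a, μ a * ν b * G.meanLoss a b := fun b => by
    simp only [cost, coLoss, Finset.mul_sum, ← Finset.sum_sub_distrib]
    exact Finset.sum_congr rfl fun a _ => by ring
  simp only [h1, hμ, mul_one, Finset.sum_sub_distrib, hν, MatrixGame.expectedLoss]
  rw [Finset.sum_comm]
  ring

theorem MatrixGame.expectedLoss_mem (G : MatrixGame A B) {μ : A → ℝ} {ν : B → ℝ}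
    (hμ : μ ∈ stdSimplex ℝ A) (hν : ν ∈ stdSimplex ℝ B) :
    G.expectedLoss μ ν ∈ Set.Icc (0 : ℝ) 1 := by
  constructor
  · exact Finset.sum_nonneg fun a _ => Finset.sum_nonneg fun b _ =>
      mul_nonneg (mul_nonneg (hμ.1 a) (hν.1 b)) (G.meanLoss_mem a b).1
  · calc G.expectedLoss μ ν ≤ ∑ a, ∑ b, μ a * ν b := Finset.sum_le_sum fun a _ =>
          Finset.sum_le_sum fun b _ => mul_le_of_le_one_right (mul_nonneg (hμ.1 a) (hν.1 b))
            (G.meanLoss_mem a b).2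
      _ = 1 := by simp [← Finset.mul_sum, hμ.2, hν.2]

theorem posSimplex_subset_stdSimplex : posSimplex A ⊆ stdSimplex ℝ A :=
  fun _ hx => ⟨fun i => (hx.1 i).le, hx.2⟩

theorem MatrixGame.exploitabilityGap_le_of_forall [Nonempty A] [Nonempty B] (G : MatrixGame A B)
    {μ : A → ℝ} {ν : B → ℝ} {r : ℝ}
    (h : ∀ μ' ∈ stdSimplex ℝ A, ∀ ν' ∈ stdSimplex ℝ B,
      G.expectedLoss μ ν' - G.expectedLoss μ' ν ≤ r) : G.exploitabilityGap μ ν ≤ r := by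
  have : Nonempty (stdSimplex ℝ A) :=
    ⟨⟨_, posSimplex_subset_stdSimplex (uniform_mem_posSimplex (I := A))⟩⟩
  have : Nonempty (stdSimplex ℝ B) :=
    ⟨⟨_, posSimplex_subset_stdSimplex (uniform_mem_posSimplex (I := B))⟩⟩
  unfold MatrixGame.exploitabilityGap
  have h1 : ∀ ν' : stdSimplex ℝ B, G.expectedLoss μ ν'.1 - r
      ≤ ⨅ μ' : stdSimplex ℝ A, G.expectedLoss μ'.1 ν := fun ν' =>
    le_ciInf fun μ' => by linarith [h _ μ'.2 _ ν'.2]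
  have h2 : (⨆ ν' : stdSimplex ℝ B, G.expectedLoss μ ν'.1)
      ≤ r + ⨅ μ' : stdSimplex ℝ A, G.expectedLoss μ'.1 ν :=
    ciSup_le fun ν' => by linarith [h1 ν']
  linarith

/-- A policy close to one with small residual is nearly a best response. -/
theorem sum_mul_cost_sub_le {I J : Type*} [Fintype I] [Fintype J] {M : I → J → ℝ}
    (hM : ∀ i j, M i j ∈ Set.Icc (0 : ℝ) 1) {τ ε : ℝ} (hτ : 0 < τ) (hε : ε ≤ 1)
    {x : I → ℝ} {q z : J → ℝ} (hx : x ∈ posSimplex I)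
    (hu : ∀ i, |kktResidual τ (cost M q) x i| ≤ ε) {x' : I → ℝ} (hx' : x' ∈ stdSimplex ℝ I) :
    ∑ i, x i * cost M q i - ∑ i, x' i * cost M z i
      ≤ τ * (Fintype.card I * (1 + ε)) + ∑ j, |q j - z j| := by
  have h1 : ∀ i, ∑ k, x k * cost M q k - cost M z i
      ≤ τ * (Fintype.card I * (1 + ε)) + ∑ j, |q j - z j| := fun i => by
    have a1 := sum_mul_sub_le_of_residual hτ hε (cost M q) hx hu i
    have a2 := (le_abs_self _).trans (abs_cost_le hM (fun j => q j - z j) i)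
    rw [cost_sub] at a2
    linarith
  have h2 := Finset.sum_le_sum fun i (_ : i ∈ Finset.univ) =>
    mul_le_mul_of_nonneg_left (h1 i) (hx'.1 i)
  rw [← Finset.sum_mul, hx'.2, one_mul] at h2
  simpa only [mul_sub, Finset.sum_sub_distrib, ← Finset.sum_mul, hx'.2, one_mul] using h2

theorem MatrixGame.exploitabilityGap_le [Nonempty A] [Nonempty B] (G : MatrixGame A B) {τ : ℝ}
    (hτ : 0 < τ) {x y : A → ℝ} {q z : B → ℝ} (hx : x ∈ posSimplex A) (hy : y ∈ posSimplex A)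
    (hq : q ∈ posSimplex B) (hz : z ∈ posSimplex B)
    (hu : ∀ a, |kktResidual τ (cost G.meanLoss q) x a| ≤ 1 / 8)
    (hv : ∀ b, |kktResidual τ (cost (coLoss G.meanLoss) x) q b| ≤ 1 / 8)
    (hD : logDiv x y + logDiv q z ≤ τ ^ 2 / 16) :
    G.exploitabilityGap y z ≤ 2 * ((Fintype.card A : ℝ) + Fintype.card B) * τ := by
  have hA : (1 : ℝ) ≤ Fintype.card A := by exact_mod_cast Fintype.card_pos
  have hB : (1 : ℝ) ≤ Fintype.card B := by exact_mod_cast Fintype.card_pos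
  refine G.exploitabilityGap_le_of_forall fun μ' hμ' ν' hν' => ?_
  -- For `τ > 1` the gap is at most `1` and the bound is trivial. Otherwise the distances cost `3 τ
  -- / 4` per player and the residual `9 τ / 8` per action, which fits in `2 τ` per action as there
  -- are at least two actions in all.
  by_cases hτ1 : τ ≤ 1
  · have n1 := logDiv_nonneg hx.1 hy.1
    have n2 := logDiv_nonneg hq.1 hz.1
    have d1 := sum_abs_sub_le_of_logDiv_le hx.1 hy (d := τ / 4) (by linarith) (by linarith)
      (by linarith)
    have d2 := sum_abs_sub_le_of_logDiv_le hq.1 hz (d := τ / 4) (by linarith) (by linarith)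
      (by linarith)
    have e1 := sum_mul_cost_sub_le G.meanLoss_mem hτ (by norm_num) (z := z) hx hu hμ'
    have e2 := sum_mul_cost_sub_le (coLoss_mem G.meanLoss_mem) hτ (by norm_num) (z := y) hq hv hν'
    rw [← G.expectedLoss_eq, ← G.expectedLoss_eq] at e1
    have f1 := G.expectedLoss_eq_one_sub hx.2 hq.2
    have f2 := G.expectedLoss_eq_one_sub hy.2 hν'.2
    have hAτ := mul_le_mul_of_nonneg_right hA hτ.le
    have hBτ := mul_le_mul_of_nonneg_right hB hτ.le
    linarith
  · have h1 := (G.expectedLoss_mem (posSimplex_subset_stdSimplex hy) hν').2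
    have h2 := (G.expectedLoss_mem hμ' (posSimplex_subset_stdSimplex hz)).1
    push Not at hτ1
    have hAτ := mul_le_mul_of_nonneg_right hA hτ.le
    have hBτ := mul_le_mul_of_nonneg_right hB hτ.le
    linarith

end Exploitability

/-! ### The parameter condition yields an admissible schedule. -/

section Parameters

/-- The regularization strengths change slowly. -/
theorem ratio_bounds {τ s l l' r r' : ℝ} (hτ : 0 < τ) (hs : 1 ≤ s) (hl : 1 ≤ l) (hll : l ≤ l')
    (hl' : l' ≤ l + 1 / s) (hr : 0 < r) (hr' : 0 < r') (hrs : r ^ 4 * s = 1)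
    (hrs' : r' ^ 4 * (s + 1) = 1) :
    1 - 1 / s ≤ τ * l * r / (τ * l' * r') ∧ τ * l * r / (τ * l' * r') ≤ 1 + 1 / s := by
  have hs0 : 0 < s := by linarith
  have hl'0 : 0 < l' := by linarith
  have e : τ * l * r / (τ * l' * r') = l / l' * (r / r') := by field_simp
  -- Here `r` and `r'` stand for `s ^ (-1/4)` and `(s + 1) ^ (-1/4)`, encoded by polynomial
  -- identities.
  have h4 : (r / r') ^ 4 = 1 + 1 / s := by
    have a : r ^ 4 = 1 / s := by field_simp; linarith
    have b : r' ^ 4 = 1 / (s + 1) := by field_simp; linarith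
    rw [div_pow, a, b]; field_simp
  have hq0 : 0 < r / r' := div_pos hr hr'
  have hq1 : 1 ≤ r / r' := by
    by_contra hc
    push Not at hc
    have := pow_lt_one₀ hq0.le hc (n := 4) (by norm_num)
    have : 0 < 1 / s := by positivity
    linarith
  have hq2 : r / r' ≤ 1 + 1 / s := h4 ▸ le_self_pow₀ hq1 (by norm_num)
  have hp1 : l / l' ≤ 1 := (div_le_one hl'0).2 hll
  have hp0 : 0 < l / l' := by positivity
  have hp2 : 1 - 1 / s ≤ l / l' := by
    rw [le_div_iff₀ hl'0]
    have h1 : 0 < 1 / s := by positivity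
    have h2 : 1 / s ≤ 1 := (div_le_one hs0).2 hs
    have h3 : (1 - 1 / s) * l' ≤ (1 - 1 / s) * (l + 1 / s) :=
      mul_le_mul_of_nonneg_left hl' (by linarith)
    have h4 : 1 / s * 1 ≤ 1 / s * l := mul_le_mul_of_nonneg_left hl h1.le
    have h5 : 0 ≤ (1 / s) * (1 / s) := by positivity
    linarith
  rw [e]
  constructor
  · calc 1 - 1 / s ≤ l / l' * 1 := by rw [mul_one]; exact hp2
      _ ≤ l / l' * (r / r') := mul_le_mul_of_nonneg_left hq1 hp0.le
  · calc l / l' * (r / r') ≤ 1 * (1 + 1 / s) := mul_le_mul hp1 hq2 hq0.le zero_le_one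
      _ = 1 + 1 / s := one_mul _

/-- Discrete form of `(1 / log s)' = -1 / (s log² s)`. It makes the errors `η^2 / τ^2` of the
schedule telescope; without the logarithm they would form a divergent harmonic series. -/
theorem one_div_mul_sq_le {s l l' : ℝ} (hs : 1 ≤ s) (hl : 1 ≤ l) (hll : l + 1 / (s + 1) ≤ l')
    (hl' : l' ≤ l + 1 / s) : 1 / (s * l ^ 2) ≤ 4 * (1 / l - 1 / l') := by
  have hs0 : 0 < s := by linarith
  have hl0 : 0 < l := by linarith
  have h1 : 0 < 1 / (s + 1) := by positivity
  have hl'0 : 0 < l' := by linarith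
  have h2 : 1 / s ≤ 1 := (div_le_one hs0).2 hs
  have h3 : l' ≤ 2 * l := by linarith
  have h4 : 1 / (2 * s) ≤ 1 / (s + 1) := one_div_le_one_div_of_le (by linarith) (by linarith)
  have e : 1 / l - 1 / l' = (l' - l) / (l * l') := by field_simp
  rw [e]
  calc 1 / (s * l ^ 2) = 4 * (1 / (2 * s) / (l * (2 * l))) := by field_simp; norm_num
    _ ≤ 4 * ((l' - l) / (l * l')) := by
        have h5 : 1 / (2 * s) ≤ l' - l := by linarith
        have h6 : 0 ≤ l' - l := le_trans (by positivity) h5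
        gcongr

/-- Discrete form of the fact that `s ^ (-3/2)` is, up to a constant, minus the derivative of `s ^
(-1/2)`, again for telescoping. -/
theorem pow_six_le {s r r' : ℝ} (hs : 1 ≤ s) (hr : 0 < r) (hrs : r ^ 4 * s = 1)
    (hrs' : r' ^ 4 * (s + 1) = 1) : r ^ 6 ≤ 4 * (r ^ 2 - r' ^ 2) := by
  have hs0 : 0 < s := by linarith
  have a : r ^ 4 = 1 / s := by field_simp; linarith
  have b : r' ^ 4 = 1 / (s + 1) := by field_simp; linarith
  have hle : r' ^ 2 ≤ r ^ 2 := by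
    refine le_of_sq_le_sq ?_ (by positivity)
    rw [← pow_mul, ← pow_mul, a, b]
    exact one_div_le_one_div_of_le hs0 (by linarith)
  have h1 : r ^ 4 - r' ^ 4 ≤ 2 * r ^ 2 * (r ^ 2 - r' ^ 2) := by
    have : r ^ 4 - r' ^ 4 = (r ^ 2 + r' ^ 2) * (r ^ 2 - r' ^ 2) := by ring
    rw [this]
    exact mul_le_mul_of_nonneg_right (by linarith) (by linarith)
  have h2 : r ^ 4 * r ^ 4 ≤ 2 * (r ^ 4 - r' ^ 4) := by
    rw [a, b, ← sub_nonneg]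
    have : 2 * (1 / s - 1 / (s + 1)) - 1 / s * (1 / s) = (s - 1) / (s ^ 2 * (s + 1)) := by
      field_simp; ring
    rw [this]
    exact div_nonneg (by linarith) (by positivity)
  have h3 : r ^ 2 * r ^ 6 ≤ r ^ 2 * (4 * (r ^ 2 - r' ^ 2)) := by
    have : r ^ 2 * r ^ 6 = r ^ 4 * r ^ 4 := by ring
    linarith
  exact le_of_mul_le_mul_left h3 (by positivity)

/-- If the constant is small then `T₀` is large. -/
theorem ParameterCondition.le_log {c δ η τ Q : ℝ} {T₀ : ℕ} (h : ParameterCondition c δ η τ T₀)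
    (hc : 0 < c) (hcQ : c < Real.exp (-Q) / 16) : Q ≤ Real.log T₀ := by
  by_contra hlt
  push Not at hlt
  -- If `T₀ < exp Q`, then `log T₀ ≥ log 2 ≥ 1 / 2` forces `η τ ≤ 16 exp Q`, against `η τ ≥ 1 / c`.
  have hT : (2 : ℝ) ≤ T₀ := by exact_mod_cast h.two_le
  have h1 : (T₀ : ℝ) < Real.exp Q := by
    rw [← Real.log_lt_iff_lt_exp (by linarith)]; exact hlt
  have h2 : 1 / 2 ≤ Real.log T₀ := by
    have : Real.log 2 ≤ Real.log T₀ := Real.log_le_log (by norm_num) hT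
    linarith [Real.log_two_gt_d9]
  have h3 : (1 / 2 : ℝ) ^ 4 ≤ Real.log T₀ ^ 4 := pow_le_pow_left₀ (by norm_num) h2 4
  have h4 : (T₀ : ℝ) / Real.log T₀ ^ 4 ≤ Real.exp Q / (1 / 2) ^ 4 := by gcongr
  have h5 := h.mul_le.trans h4
  have hητ : 0 < η * τ := mul_pos h.eta_pos h.tau_pos
  have h6 : 1 ≤ c * (η * τ) := (div_le_iff₀ hητ).1 h.inv_le
  have h7 : c * (η * τ) ≤ c * (Real.exp Q / (1 / 2) ^ 4) := mul_le_mul_of_nonneg_left h5 hc.le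
  have h8 : c * (Real.exp Q / (1 / 2) ^ 4) < Real.exp (-Q) / 16 * (Real.exp Q / (1 / 2) ^ 4) :=
    mul_lt_mul_of_pos_right hcQ (by positivity)
  have h9 : Real.exp (-Q) / 16 * (Real.exp Q / (1 / 2) ^ 4) = 1 := by
    rw [Real.exp_neg]; field_simp; norm_num
  linarith

/-- With `s = t + T₀`, `l = log (s / δ)` and `r = s ^ (-1/4)`, one has `η^t = η r³`, `τ^t = τ l r`
and `η^t τ^t = η τ l / s`. Thus the contraction rate dominates the relative change `1 / s` of `τ^t`
once `η τ` is large. -/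
theorem ParameterCondition.goodSchedule {K : ℕ} (hK : 1 ≤ K) {δ : ℝ} (hδ : 0 < δ) (hδ1 : δ < 1) :
    ∃ c : ℝ, 0 < c ∧ ∃ ε : ℝ, ∀ (η τ : ℝ) (T₀ : ℕ), ParameterCondition c δ η τ T₀ →
      GoodSchedule K δ ε (learningRate η T₀) (regStrength τ δ T₀) := by
  have hK1 : (1 : ℝ) ≤ K := by exact_mod_cast hK
  set L := Real.log (1 / δ) with hL
  have hL0 : 0 < L := Real.log_pos (by rw [lt_div_iff₀ hδ]; linarith)
  set Q : ℝ := 128 * K * (1 + L) with hQ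
  have hKL : 0 < (K : ℝ) * L := by positivity
  have hQ1 : 1 ≤ Q := by rw [hQ]; linarith
  -- The first entry forces `log T₀ ≥ Q` (`17` instead of `16` gives a strict inequality); the
  -- second pays for the budget `2560 K c ≤ δ` and makes `η τ` at least a large multiple of `K`.
  set c := min (Real.exp (-Q) / 17) (δ / (3200 * K)) with hc
  have hc0 : 0 < c := lt_min (by positivity) (by positivity)
  have hcQ : c < Real.exp (-Q) / 16 :=
    (min_le_left _ _).trans_lt (div_lt_div_of_pos_left (Real.exp_pos _) (by norm_num) (by norm_num))
  have hcδ : c * (3200 * K) ≤ δ := (le_div_iff₀ (by positivity)).1 (min_le_right _ _)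
  have hcK : c * (3200 * K) ≤ 1 := hcδ.trans hδ1.le
  have hc1 : c ≤ 1 / 3200 := by
    have : c * 3200 * 1 ≤ c * 3200 * K := mul_le_mul_of_nonneg_left hK1 (by positivity)
    linarith
  have hε2 : (1 / (8 * √(K : ℝ))) ^ 2 = 1 / (64 * K) := by
    rw [div_pow, mul_pow, Real.sq_sqrt (by positivity)]; norm_num
  have hε0 : 0 < 1 / (8 * √(K : ℝ)) := by positivity
  refine ⟨c, hc0, 1 / (8 * √(K : ℝ)), fun η τ T₀ h => ?_⟩
  have hη := h.eta_pos
  have hτ := h.tau_pos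
  have hητ : 0 < η * τ := mul_pos hη hτ
  have hcητ : 1 ≤ c * (η * τ) := (div_le_iff₀ hητ).1 h.inv_le
  have hητ1 : 256 * K ≤ η * τ := by
    have h1 : c * (3200 * K) * (η * τ) ≤ 1 * (η * τ) := mul_le_mul_of_nonneg_right hcK hητ.le
    have h2 : 3200 * K * 1 ≤ 3200 * K * (c * (η * τ)) :=
      mul_le_mul_of_nonneg_left hcητ (by positivity)
    linarith
  have hηc := h.eta_le
  have hτ1 : 1 ≤ τ := by
    have : η * τ ≤ 1 * τ := mul_le_mul_of_nonneg_right (by linarith) hτ.le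
    linarith
  have hlogQ : Q ≤ Real.log T₀ := h.le_log hc0 hcQ
  have hT : (2 : ℝ) ≤ T₀ := by exact_mod_cast h.two_le
  set s : ℕ → ℝ := fun t => (t : ℝ) + T₀ with hs
  set l : ℕ → ℝ := fun t => Real.log (((t : ℝ) + T₀) / δ) with hl
  set r : ℕ → ℝ := fun t => ((t : ℝ) + T₀) ^ (-(1 / 4) : ℝ) with hr
  have hsT : ∀ t, (T₀ : ℝ) ≤ s t := fun t => le_add_of_nonneg_left (Nat.cast_nonneg t)
  have hs0 : ∀ t, 0 < s t := fun t => by linarith [hsT t]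
  have hs1 : ∀ t, 1 ≤ s t := fun t => by linarith [hsT t]
  have hss : ∀ t, s (t + 1) = s t + 1 := fun t => by simp only [hs]; push_cast; ring
  have hle : ∀ t, l t = Real.log (s t) + L := fun t => by
    simp only [hl, hL]
    rw [div_eq_mul_one_div, Real.log_mul (hs0 t).ne' (by positivity)]
  have hlogs : ∀ t, Real.log T₀ ≤ Real.log (s t) := fun t =>
    Real.log_le_log (by linarith) (hsT t)
  have hl1 : ∀ t, 1 ≤ l t := fun t => by rw [hle]; linarith [hlogs t]
  have hr0 : ∀ t, 0 < r t := fun t => Real.rpow_pos_of_pos (hs0 t) _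
  have hr4 : ∀ t, r t ^ 4 * s t = 1 := fun t => by
    have : r t ^ 4 = (s t)⁻¹ := by
      rw [← Real.rpow_natCast, ← Real.rpow_mul (hs0 t).le, ← Real.rpow_neg_one]
      norm_num
    rw [this, inv_mul_cancel₀ (hs0 t).ne']
  have hr1 : ∀ t, r t ≤ 1 := fun t => Real.rpow_le_one_of_one_le_of_nonpos (hs1 t) (by norm_num)
  have hηt : ∀ t, learningRate η T₀ t = η * r t ^ 3 := fun t => by
    have : r t ^ 3 = s t ^ (-(3 / 4) : ℝ) := by
      rw [← Real.rpow_natCast, ← Real.rpow_mul (hs0 t).le]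
      norm_num
    rw [this]; rfl
  have hτt : ∀ t, regStrength τ δ T₀ t = τ * l t * r t := fun t => rfl
  have hlu : ∀ t, l (t + 1) ≤ l t + 1 / s t := fun t => by
    rw [hle, hle, hss]
    have h1 := Real.log_le_sub_one_of_pos (x := (s t + 1) / s t)
      (div_pos (by linarith [hs0 t]) (hs0 t))
    rw [Real.log_div (by linarith [hs0 t]) (hs0 t).ne'] at h1
    have h2 : (s t + 1) / s t - 1 = 1 / s t := by have := (hs0 t).ne'; field_simp; ring
    linarith
  have hll : ∀ t, l t + 1 / (s t + 1) ≤ l (t + 1) := fun t => by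
    rw [hle, hle, hss]
    have h1 := Real.one_sub_inv_le_log_of_pos (x := (s t + 1) / s t)
      (div_pos (by linarith [hs0 t]) (hs0 t))
    rw [Real.log_div (by linarith [hs0 t]) (hs0 t).ne'] at h1
    have h2 : 1 - ((s t + 1) / s t)⁻¹ = 1 / (s t + 1) := by
      have := (hs0 t).ne'
      have : s t + 1 ≠ 0 := by linarith [hs0 t]
      field_simp; ring
    linarith
  have hll0 : ∀ t, l t ≤ l (t + 1) := fun t => by
    have : 0 < 1 / (s t + 1) := by have := hs0 t; positivity
    linarith [hll t]
  have hratio : ∀ t, 1 - 1 / s t ≤ regStrength τ δ T₀ t / regStrength τ δ T₀ (t + 1) ∧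
      regStrength τ δ T₀ t / regStrength τ δ T₀ (t + 1) ≤ 1 + 1 / s t := fun t => by
    rw [hτt, hτt]
    exact ratio_bounds hτ (hs1 t) (hl1 t) (hll0 t) (hlu t) (hr0 t) (hr0 _) (hr4 t)
      (by rw [← hss]; exact hr4 _)
  have hτpos : ∀ t, 0 < regStrength τ δ T₀ t := fun t => by
    rw [hτt]; exact mul_pos (mul_pos hτ (by linarith [hl1 t])) (hr0 t)
  have hηpos : ∀ t, 0 < learningRate η T₀ t := fun t => by
    rw [hηt]; exact mul_pos hη (pow_pos (hr0 t) 3)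
  have hht : ∀ t, learningRate η T₀ t * regStrength τ δ T₀ t = η * τ * (l t / s t) := fun t => by
    have : l t / s t = l t * r t ^ 4 := by
      have := hr4 t
      rw [div_eq_iff (hs0 t).ne']; linear_combination (-l t) * this
    rw [hηt, hτt, this]; ring
  have hhlow : ∀ t, η * τ * (1 / s t) ≤ learningRate η T₀ t * regStrength τ δ T₀ t := fun t => by
    rw [hht]
    have := hs0 t
    have := hl1 t
    gcongr
  refine ⟨hε0, ?_, ?_, hηpos, fun t => ?_, hτpos, fun t => ?_, fun t => ?_, fun t => ?_, ?_,
    fun t => ?_, fun n => ?_⟩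
  · rw [one_div_le_one_div (by positivity) (by norm_num)]
    have : 1 ≤ √(K : ℝ) := Real.one_le_sqrt.2 hK1
    linarith
  · rw [hε2]
    exact le_of_eq (by field_simp)
  · rw [hηt]
    have : η * r t ^ 3 ≤ η * 1 := mul_le_mul_of_nonneg_left
      (pow_le_one₀ (hr0 t).le (hr1 t)) hη.le
    linarith
  · rw [hht]
    -- The function `log x / x` decreases beyond `e`, and `l ≥ 1` says precisely that `s / δ ≥ e`.
    have h0 : l t / s t ≤ l 0 / s 0 := by
      have hmem : ∀ t, Real.exp 1 ≤ s t / δ := fun t => by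
        rw [← Real.le_log_iff_exp_le (div_pos (hs0 t) hδ)]
        exact hl1 t
      have := Real.log_div_self_antitoneOn (hmem 0) (hmem t)
        (div_le_div_of_nonneg_right (by simp [hs]) hδ.le)
      have e : ∀ t, Real.log (s t / δ) / (s t / δ) = δ * (l t / s t) := fun t => by
        have := (hs0 t).ne'
        simp only [hl, hs]; field_simp
      simp only [e] at this
      exact le_of_mul_le_mul_left this hδ
    have hs00 : s 0 = T₀ := by simp [hs]
    have hlog1 : 1 ≤ Real.log T₀ := hQ1.trans hlogQ
    have hlog0 : 0 < Real.log T₀ := by linarith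
    calc η * τ * (l t / s t) ≤ (T₀ : ℝ) / Real.log T₀ ^ 4 * (l 0 / s 0) := by
          have := hl1 t
          have := hs0 t
          exact mul_le_mul h.mul_le h0 (by positivity) (by positivity)
      _ = (Real.log T₀ + L) / Real.log T₀ ^ 4 := by
          rw [hle, hs00]; field_simp
      _ ≤ 1 / 2 := by
          rw [div_le_iff₀ (by positivity)]
          have a1 : Real.log T₀ ^ 2 ≤ Real.log T₀ ^ 4 := pow_le_pow_right₀ hlog1 (by norm_num)
          have a2 : 2 * (1 + L) ≤ Real.log T₀ := by
            have : 128 * (1:ℝ) * (1 + L) ≤ Q := by rw [hQ]; gcongr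
            linarith
          have a3 : 2 * (1 + L) * Real.log T₀ ≤ Real.log T₀ * Real.log T₀ :=
            mul_le_mul_of_nonneg_right a2 hlog0.le
          have a4 : L * 1 ≤ L * Real.log T₀ := mul_le_mul_of_nonneg_left hlog1 hL0.le
          rw [sq] at a1
          linarith
  · rw [hηt, hτt]
    have a1 : r t ^ 3 ≤ r t := pow_le_of_le_one (hr0 t).le (hr1 t) (by norm_num)
    calc 4 * (η * r t ^ 3) = (4 * η) * r t ^ 3 := by ring
      _ ≤ (τ * l t) * r t := by
          refine mul_le_mul ?_ a1 (pow_pos (hr0 t) 3).le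
            (mul_nonneg hτ.le (by linarith [hl1 t]))
          have : 1 * 1 ≤ τ * l t := mul_le_mul hτ1 (hl1 t) zero_le_one hτ.le
          linarith
  · rw [hε2]
    have a1 : |regStrength τ δ T₀ t / regStrength τ δ T₀ (t + 1) - 1| ≤ 1 / s t :=
      abs_le.2 ⟨by linarith [(hratio t).1], by linarith [(hratio t).2]⟩
    refine a1.trans ?_
    have a2 : 256 * K * (1 / s t) ≤ η * τ * (1 / s t) :=
      mul_le_mul_of_nonneg_right hητ1 (by have := hs0 t; positivity)
    have a3 := a2.trans (hhlow t)
    rw [mul_one_div, div_div, le_div_iff₀ (by positivity)]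
    have : 0 < 1 / s t := by have := hs0 t; positivity
    have : 0 < 1 / s t * K := by positivity
    linarith
  · rw [hε2, div_le_div_iff₀ (pow_pos (hτpos 0) 2) (by positivity), one_mul]
    rw [hτt]
    have hs00 : s 0 = T₀ := by simp [hs]
    -- The hypothesis on `T₀` reads `L τ² r² ≥ 1` at time `0`; one factor `l 0 ≥ 128 K L` then gives
    -- `τ_0² ≥ 128 K`.
    have b1 : (T₀ : ℝ) ≤ (L * τ ^ 2) ^ 2 := by
      have := h.le_pow
      rw [mul_pow, ← pow_mul]; exact this
    have b2 : (1 : ℝ) ≤ (L * τ ^ 2 * r 0 ^ 2) ^ 2 := by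
      have := hr4 0
      rw [hs00] at this
      calc (1 : ℝ) = r 0 ^ 4 * T₀ := this.symm
        _ ≤ r 0 ^ 4 * (L * τ ^ 2) ^ 2 := mul_le_mul_of_nonneg_left b1 (pow_pos (hr0 0) 4).le
        _ = (L * τ ^ 2 * r 0 ^ 2) ^ 2 := by ring
    have b3 : 1 ≤ L * τ ^ 2 * r 0 ^ 2 :=
      (one_le_sq_iff₀ (by have := hr0 0; positivity)).1 b2
    have b4 : 128 * K * L ≤ l 0 := by
      have : 128 * K * (1 + L) ≤ l 0 := by
        rw [hle]; linarith [hlogs 0]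
      linarith
    have b5 : 128 * K * L ≤ l 0 ^ 2 := b4.trans (by have := hl1 0; nlinarith)
    have b6 : 128 * K * 1 ≤ 128 * K * (L * τ ^ 2 * r 0 ^ 2) :=
      mul_le_mul_of_nonneg_left b3 (by positivity)
    have b7 : 128 * K * L * (τ ^ 2 * r 0 ^ 2) ≤ l 0 ^ 2 * (τ ^ 2 * r 0 ^ 2) :=
      mul_le_mul_of_nonneg_right b5 (by positivity)
    have b8 : (τ * l 0 * r 0) ^ 2 = l 0 ^ 2 * (τ ^ 2 * r 0 ^ 2) := by ring
    rw [b8]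
    linarith
  · have a0 : 0 < 1 / s t := by have := hs0 t; positivity
    have a01 : 1 / s t ≤ 1 := (div_le_one (hs0 t)).2 (hs1 t)
    have a1 : 6 * (1 / s t) ≤ learningRate η T₀ t * regStrength τ δ T₀ t := by
      refine le_trans ?_ (hhlow t)
      exact mul_le_mul_of_nonneg_right (by linarith) a0.le
    have a2 := (div_le_iff₀ (hτpos (t + 1))).1 (hratio t).2
    set w := 1 / s t
    have a3 : regStrength τ δ T₀ t ^ 2 ≤ ((1 + w) * regStrength τ δ T₀ (t + 1)) ^ 2 :=
      pow_le_pow_left₀ (hτpos t).le a2 2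
    have a4 : (1 - learningRate η T₀ t * regStrength τ δ T₀ t / 2) * regStrength τ δ T₀ t ^ 2
        ≤ (1 - 3 * w) * regStrength τ δ T₀ t ^ 2 :=
      mul_le_mul_of_nonneg_right (by linarith) (sq_nonneg _)
    refine a4.trans ?_
    have a5 : 0 ≤ regStrength τ δ T₀ (t + 1) ^ 2 := sq_nonneg _
    by_cases hw : 3 * w ≤ 1
    · have a6 := mul_le_mul_of_nonneg_left a3 (by linarith : 0 ≤ 1 - 3 * w)
      refine a6.trans ?_
      have : (1 - 3 * w) * (1 + w) ^ 2 ≤ 1 := by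
        have : 0 < w ^ 3 := by positivity
        have : 0 < w ^ 2 := by positivity
        linarith
      calc (1 - 3 * w) * ((1 + w) * regStrength τ δ T₀ (t + 1)) ^ 2
          = (1 - 3 * w) * (1 + w) ^ 2 * regStrength τ δ T₀ (t + 1) ^ 2 := by ring
        _ ≤ 1 * regStrength τ δ T₀ (t + 1) ^ 2 := mul_le_mul_of_nonneg_right this a5
        _ = _ := one_mul _
    · push Not at hw
      exact (mul_nonpos_of_nonpos_of_nonneg (by linarith) (sq_nonneg _)).trans a5
  -- Replacing `τ^(t+1)` by `τ^t` costs `2² = 4`, telescoping costs another `4`, hence `1280 = 80 ·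
  -- 16`.
  · have hterm : ∀ t, 80 * K * (learningRate η T₀ t ^ 2
        + (learningRate η T₀ t * regStrength τ δ T₀ t) ^ 2) / regStrength τ δ T₀ (t + 1) ^ 2
        ≤ 1280 * K * η ^ 2 * ((1 / l t + r t ^ 2) - (1 / l (t + 1) + r (t + 1) ^ 2)) := by
      intro t
      have a01 : 1 / s t ≤ 1 := (div_le_one (hs0 t)).2 (hs1 t)
      have a2 : regStrength τ δ T₀ t / regStrength τ δ T₀ (t + 1) ≤ 2 := by
        linarith [(hratio t).2]
      have a3 : (regStrength τ δ T₀ t / regStrength τ δ T₀ (t + 1)) ^ 2 ≤ 2 ^ 2 :=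
        pow_le_pow_left₀ (div_pos (hτpos t) (hτpos _)).le a2 2
      have p1 := one_div_mul_sq_le (hs1 t) (hl1 t) (hll t) (hlu t)
      have p2 := pow_six_le (hs1 t) (hr0 t) (hr4 t) (by rw [← hss]; exact hr4 _)
      have hτne := (hτpos t).ne'
      have hτne' := (hτpos (t + 1)).ne'
      have hlne : l t ≠ 0 := by linarith [hl1 t]
      have hrne := (hr0 t).ne'
      have hsne := (hs0 t).ne'
      have e1 : 80 * K * (learningRate η T₀ t ^ 2
        + (learningRate η T₀ t * regStrength τ δ T₀ t) ^ 2) / regStrength τ δ T₀ (t + 1) ^ 2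
        = 80 * K * (learningRate η T₀ t ^ 2 / regStrength τ δ T₀ t ^ 2 + learningRate η T₀ t ^ 2)
          * (regStrength τ δ T₀ t / regStrength τ δ T₀ (t + 1)) ^ 2 := by
        field_simp
      have e2 : learningRate η T₀ t ^ 2 / regStrength τ δ T₀ t ^ 2
          = η ^ 2 / τ ^ 2 * (1 / (s t * l t ^ 2)) := by
        have : 1 / (s t * l t ^ 2) = r t ^ 4 / l t ^ 2 := by
          rw [div_eq_div_iff (by positivity) (by positivity)]
          linear_combination (-l t ^ 2) * hr4 t
        rw [this, hηt, hτt]; field_simp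
      have e3 : learningRate η T₀ t ^ 2 = η ^ 2 * r t ^ 6 := by rw [hηt]; ring
      rw [e1, e2, e3]
      have q1 : η ^ 2 / τ ^ 2 ≤ η ^ 2 := div_le_self (sq_nonneg _) (one_le_pow₀ hτ1)
      have q2 : 0 ≤ 1 / (s t * l t ^ 2) := by have := hs0 t; positivity
      calc 80 * K * (η ^ 2 / τ ^ 2 * (1 / (s t * l t ^ 2)) + η ^ 2 * r t ^ 6)
          * (regStrength τ δ T₀ t / regStrength τ δ T₀ (t + 1)) ^ 2
          ≤ 80 * K * (η ^ 2 * (4 * (1 / l t - 1 / l (t + 1)))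
            + η ^ 2 * (4 * (r t ^ 2 - r (t + 1) ^ 2))) * 2 ^ 2 := by
            have := hr0 t
            have : η ^ 2 / τ ^ 2 * (1 / (s t * l t ^ 2))
              ≤ η ^ 2 * (4 * (1 / l t - 1 / l (t + 1))) := mul_le_mul q1 p1 q2 (sq_nonneg _)
            have : 0 ≤ η ^ 2 / τ ^ 2 * (1 / (s t * l t ^ 2)) := by positivity
            have q5 : η ^ 2 * r t ^ 6 ≤ η ^ 2 * (4 * (r t ^ 2 - r (t + 1) ^ 2)) := by gcongr
            have : 0 ≤ η ^ 2 * r t ^ 6 := by positivity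
            refine mul_le_mul ?_ a3 (sq_nonneg _) ?_
            · exact mul_le_mul_of_nonneg_left (by linarith) (by positivity)
            · exact mul_nonneg (by positivity) (by linarith)
        _ = _ := by ring
    refine (Finset.sum_le_sum fun t _ => hterm t).trans ?_
    rw [← Finset.mul_sum, Finset.sum_range_sub' (fun t => 1 / l t + r t ^ 2)]
    have c1 : 1 / l 0 ≤ 1 := (div_le_one (by linarith [hl1 0])).2 (hl1 0)
    have c2 : r 0 ^ 2 ≤ 1 := pow_le_one₀ (hr0 0).le (hr1 0)
    have c3 : 0 < 1 / l n := by have := hl1 n; positivity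
    have c4 : 0 < r n ^ 2 := pow_pos (hr0 n) 2
    have c5 : η ^ 2 ≤ c * 1 := by
      rw [sq]; exact mul_le_mul hηc (by linarith) hη.le hc0.le
    calc 1280 * K * η ^ 2 * (1 / l 0 + r 0 ^ 2 - (1 / l n + r n ^ 2))
        ≤ 1280 * K * (c * 1) * 2 := by
          refine mul_le_mul ?_ (by linarith) ?_ (by positivity)
          · exact mul_le_mul_of_nonneg_left c5 (by positivity)
          · have := Finset.sum_nonneg (s := Finset.range n) fun t _ => (by
              have p1 := one_div_mul_sq_le (hs1 t) (hl1 t) (hll t) (hlu t)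
              have p2 := pow_six_le (hs1 t) (hr0 t) (hr4 t)
                (by rw [← hss]; exact hr4 _)
              have q1 : 0 ≤ 1 / (s t * l t ^ 2) := by have := hs0 t; positivity
              have q2 := pow_pos (hr0 t) 6
              linarith :
              0 ≤ (1 / l t + r t ^ 2) - (1 / l (t + 1) + r (t + 1) ^ 2))
            rwa [Finset.sum_range_sub' (fun t => 1 / l t + r t ^ 2)] at this
      _ ≤ δ := by
        have : 0 ≤ c * K := by positivity
        linarith

end Parameters

/-! ### From conditional laws to conditional expectations. -/

section CondLaw

variable {Ω : Type*} {m : MeasurableSpace Ω} [mΩ : MeasurableSpace Ω] {P : Measure Ω}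
  [IsProbabilityMeasure P]

theorem integrable_comp_unitInterval {φ : unitInterval → ℝ} (hφ : Continuous φ) {X : Ω → unitInterval}
    (hX : Measurable X) : Integrable (fun ω => φ (X ω)) P := by
  obtain ⟨C, hC⟩ := isCompact_univ.exists_bound_of_continuousOn hφ.continuousOn
  exact Integrable.of_bound (hφ.measurable.comp hX).aestronglyMeasurable C
    (Filter.Eventually.of_forall fun ω => hC _ (Set.mem_univ _))

/-- If, on the event `E`, the conditional law of `X` given `m` is `p • Q`, then integrals against it
are conditional expectations. -/
theorem condExp_indicator_comp_of_cond_law (hm : m ≤ mΩ) {E : Set Ω} (hE : MeasurableSet E)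
    {X : Ω → unitInterval} (hX : Measurable X) {p : Ω → ℝ} (hpm : Measurable[m] p)
    (hp0 : ∀ ω, 0 ≤ p ω) (hp1 : ∀ ω, p ω ≤ 1) {Q : Measure unitInterval} [IsProbabilityMeasure Q]
    (hlaw : ∀ T : Set unitInterval, MeasurableSet T →
      P⟦{ω | ω ∈ E ∧ X ω ∈ T} | m⟧ =ᵐ[P] fun ω => p ω * Q.real T)
    {φ : unitInterval → ℝ} (hφ : Continuous φ) :
    P[E.indicator fun ω => φ (X ω) | m] =ᵐ[P] fun ω => p ω * ∫ x, φ x ∂Q := by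
  have hpint : Integrable p P := Integrable.of_bound (hpm.mono hm le_rfl).aestronglyMeasurable 1
    (Filter.Eventually.of_forall fun ω => by
      rw [Real.norm_eq_abs, abs_of_nonneg (hp0 ω)]; exact hp1 ω)
  refine (ae_eq_condExp_of_forall_setIntegral_eq hm
    ((integrable_comp_unitInterval hφ hX).indicator hE)
    (fun S _ _ => (hpint.mul_const _).integrableOn) (fun S hS _ => ?_)
    (hpm.mul_const _).stronglyMeasurable.aestronglyMeasurable).symm
  have hS' := hm S hS
  have hI0 : 0 ≤ ∫ ω in S, p ω ∂P := integral_nonneg hp0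
  -- The hypothesis on sets identifies the law of `X` on `S ∩ E` as a multiple of `Q`; integrating
  -- `φ` against both measures gives the claim.
  have hmeas : (P.restrict (S ∩ E)).map X = ENNReal.ofReal (∫ ω in S, p ω ∂P) • Q := by
    ext T hT
    have hset : MeasurableSet {ω | ω ∈ E ∧ X ω ∈ T} := hE.inter (hX hT)
    have h1 := setIntegral_condExp (μ := P) hm
      (f := Set.indicator {ω | ω ∈ E ∧ X ω ∈ T} fun _ => (1 : ℝ))
      ((integrable_const (1 : ℝ)).indicator hset) hS
    rw [setIntegral_congr_ae hS' ((hlaw T hT).mono fun ω h _ => h), integral_mul_const,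
      setIntegral_indicator hset, setIntegral_const, smul_eq_mul, mul_one] at h1
    rw [Measure.map_apply hX hT, Measure.restrict_apply (hX hT), Measure.smul_apply, smul_eq_mul,
      ← ofReal_measureReal (μ := Q), ← ENNReal.ofReal_mul hI0, h1, ofReal_measureReal]
    congr 1
    ext ω
    simp only [Set.mem_inter_iff, Set.mem_preimage, Set.mem_ofPred_eq]
    tauto
  rw [integral_mul_const, setIntegral_indicator hE,
    ← integral_map hX.aemeasurable hφ.measurable.aestronglyMeasurable, hmeas,
    integral_smul_measure, ENNReal.toReal_ofReal hI0, smul_eq_mul]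

end CondLaw

/-! ### Maximal inequality. -/

section Maximal

variable {Ω : Type*} [mΩ : MeasurableSpace Ω] {P : Measure Ω} [IsProbabilityMeasure P]

/-- A maximal inequality for nonnegative processes that are supermartingales up to errors `e`. -/
theorem one_sub_le_measureReal_forall_le (𝓕 : Filtration ℕ mΩ) {Y : ℕ → Ω → ℝ}
    (hYm : ∀ t, Measurable[𝓕 t] (Y t)) (hYi : ∀ t, Integrable (Y t) P) (hY0 : ∀ t ω, 0 ≤ Y t ω)
    (hinit : ∀ ω, Y 0 ω = 0) {e : ℕ → ℝ} {δ : ℝ}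
    (hstep : ∀ t S, MeasurableSet[𝓕 t] S → ∫ ω in S, Y (t + 1) ω ∂P ≤ ∫ ω in S, Y t ω ∂P + e t)
    (hbudget : ∀ n, ∑ t ∈ Finset.range n, e t ≤ δ) :
    1 - δ ≤ P.real {ω | ∀ t, Y t ω ≤ 1} := by
  set A : ℕ → Set Ω := fun n => {ω | ∀ t ≤ n, Y t ω ≤ 1} with hA
  have hAm : ∀ n, MeasurableSet[𝓕 n] (A n) := fun n => by
    have : A n = ⋂ t, ⋂ _ : t ≤ n, {ω | Y t ω ≤ 1} := by ext ω; simp [hA]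
    rw [this]
    exact MeasurableSet.iInter fun t => MeasurableSet.iInter fun ht =>
      𝓕.mono ht _ ((hYm t) measurableSet_Iic)
  have hAm' : ∀ n, MeasurableSet (A n) := fun n => 𝓕.le n _ (hAm n)
  have hanti : Antitone A := fun n n' h ω hω t ht => hω t (ht.trans h)
  -- The process is followed only until it first exceeds `1`: the mass already lost plus the
  -- remaining expectation is bounded by the accumulated errors. Lost mass is paid for by `Y (n + 1)
  -- > 1` on `A n \ A (n + 1)`.
  have hclaim : ∀ n, 1 - P.real (A n) + ∫ ω in A n, Y n ω ∂P ≤ ∑ t ∈ Finset.range n, e t := by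
    intro n
    induction n with
    | zero =>
      have : A 0 = Set.univ := by
        ext ω; simp [hA, hinit]
      simp [this, hinit]
    | succ n ih =>
      have hsub : A (n + 1) ⊆ A n := hanti (Nat.le_succ n)
      have h1 := hstep n (A n) (hAm n)
      have h2 := integral_inter_add_sdiff (μ := P) (s := A n) (hAm' (n + 1))
        (hYi (n + 1)).integrableOn
      rw [Set.inter_eq_self_of_subset_right hsub] at h2
      have h3 : P.real (A n \ A (n + 1)) ≤ ∫ ω in A n \ A (n + 1), Y (n + 1) ω ∂P := by
        have := setIntegral_mono_on (μ := P) (s := A n \ A (n + 1)) (f := fun _ => (1 : ℝ))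
          (g := Y (n + 1)) (integrable_const _).integrableOn (hYi (n + 1)).integrableOn
          ((hAm' n).diff (hAm' (n + 1))) fun ω hω => by
            by_contra hc
            refine hω.2 fun t ht => ?_
            rcases Nat.le_succ_iff.1 ht with ht | rfl
            · exact hω.1 t ht
            · exact (not_le.1 hc).le
        simpa using this
      rw [measureReal_sdiff hsub (hAm' (n + 1))] at h3
      rw [Finset.sum_range_succ]
      linarith
  have hinter : {ω | ∀ t, Y t ω ≤ 1} = ⋂ n, A n := by
    ext ω
    simp only [hA, Set.mem_ofPred_eq, Set.mem_iInter]
    exact ⟨fun h n t _ => h t, fun h t => h t t le_rfl⟩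
  rw [hinter]
  have hlim := tendsto_measure_iInter_atTop (μ := P) (fun n => (hAm' n).nullMeasurableSet) hanti
    ⟨0, measure_ne_top _ _⟩
  have hlim' := (ENNReal.tendsto_toReal (measure_ne_top P (⋂ n, A n))).comp hlim
  refine ge_of_tendsto' hlim' fun n => ?_
  have h1 := hclaim n
  have h2 : 0 ≤ ∫ ω in A n, Y n ω ∂P := integral_nonneg (hY0 n)
  have h3 := hbudget n
  change 1 - δ ≤ P.real (A n)
  linarith

end Maximal

/-! ### Expectations over one round of play. -/

section BanditPlay

variable {A B Ω : Type*} [Fintype A] [Fintype B]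
  [MeasurableSpace A] [MeasurableSpace B]
  [MeasurableSingletonClass A] [MeasurableSingletonClass B]
  [mΩ : MeasurableSpace Ω] {G : MatrixGame A B} {P : Measure Ω} [IsProbabilityMeasure P]
  {𝓕 : Filtration ℕ mΩ} {μ : ℕ → Ω → A → ℝ} {ν : ℕ → Ω → B → ℝ}
  {act₁ : ℕ → Ω → A} {act₂ : ℕ → Ω → B} {loss : ℕ → Ω → unitInterval}

/-- Integration of a function of the actions and of the loss of a round over an event of the
past. -/
theorem IsBanditPlay.setIntegral_eq (h : IsBanditPlay G P 𝓕 μ ν act₁ act₂ loss) {t : ℕ}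
    (hμ : ∀ ω, μ t ω ∈ posSimplex A) (hν : ∀ ω, ν t ω ∈ posSimplex B)
    {W : A → B → Ω → ℝ} (hWm : ∀ a b, Measurable[𝓕 t] (W a b)) {C : ℝ}
    (hWb : ∀ a b ω, |W a b ω| ≤ C) {φ : unitInterval → ℝ} (hφ : Continuous φ)
    {S : Set Ω} (hS : MeasurableSet[𝓕 t] S) :
    Integrable (fun ω => W (act₁ t ω) (act₂ t ω) ω * φ (loss t ω)) P ∧
    ∫ ω in S, W (act₁ t ω) (act₂ t ω) ω * φ (loss t ω) ∂P
      = ∫ ω in S, ∑ a, ∑ b, W a b ω * (μ t ω a * ν t ω b *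
          ∫ x, φ x ∂(G.law a b : Measure unitInterval)) ∂P := by
  have hle := 𝓕.le t
  have hloss : Measurable (loss t) := (h.measurable_loss t).mono (𝓕.le (t + 1)) le_rfl
  set E : A → B → Set Ω := fun a b => {ω | act₁ t ω = a ∧ act₂ t ω = b} with hE_def
  have hE : ∀ a b, MeasurableSet (E a b) := fun a b =>
    (((h.measurable_act₁ t).mono (𝓕.le (t + 1)) le_rfl) (measurableSet_singleton a)).inter
      (((h.measurable_act₂ t).mono (𝓕.le (t + 1)) le_rfl) (measurableSet_singleton b))
  set g : A → B → Ω → ℝ := fun a b => (E a b).indicator fun ω => φ (loss t ω) with hg_def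
  have hg : ∀ a b, Integrable (g a b) P := fun a b =>
    (integrable_comp_unitInterval hφ hloss).indicator (hE a b)
  have hWg : ∀ a b, Integrable (fun ω => W a b ω * g a b ω) P := fun a b =>
    (hg a b).bdd_mul ((hWm a b).mono hle le_rfl).aestronglyMeasurable
      (Filter.Eventually.of_forall fun ω => hWb a b ω)
  have hdecomp : (fun ω => W (act₁ t ω) (act₂ t ω) ω * φ (loss t ω))
      = fun ω => ∑ a, ∑ b, W a b ω * g a b ω := by
    funext ω
    rw [Finset.sum_eq_single (act₁ t ω) (fun a _ ha => Finset.sum_eq_zero fun b _ => ?_) (by simp),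
      Finset.sum_eq_single (act₂ t ω) (fun b _ hb => ?_) (by simp)]
    · simp [hg_def, hE_def]
    · simp [hg_def, hE_def, hb.symm]
    · simp [hg_def, hE_def, ha.symm]
  have hpm : ∀ a b, Measurable[𝓕 t] fun ω => μ t ω a * ν t ω b := fun a b =>
    ((measurable_pi_apply a).comp (h.measurable_policy₁ t)).mul
      ((measurable_pi_apply b).comp (h.measurable_policy₂ t))
  have hp0 : ∀ a b ω, 0 ≤ μ t ω a * ν t ω b := fun a b ω =>
    mul_nonneg ((hμ ω).1 a).le ((hν ω).1 b).le
  have hp1 : ∀ a b ω, μ t ω a * ν t ω b ≤ 1 := fun a b ω =>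
    mul_le_one₀ (posSimplex_le_one (hμ ω) a) ((hν ω).1 b).le (posSimplex_le_one (hν ω) b)
  have hcond : ∀ a b, P[g a b | 𝓕 t] =ᵐ[P] fun ω => μ t ω a * ν t ω b *
      ∫ x, φ x ∂(G.law a b : Measure unitInterval) := fun a b => by
    refine condExp_indicator_comp_of_cond_law hle (hE a b) hloss (hpm a b) (hp0 a b) (hp1 a b)
      (fun T hT => ?_) hφ
    have := h.cond_law t a b T hT
    simpa only [hE_def, Set.mem_ofPred_eq, and_assoc] using this
  have hterm : ∀ a b, ∫ ω in S, W a b ω * g a b ω ∂P = ∫ ω in S, W a b ω * (μ t ω a * ν t ω b *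
      ∫ x, φ x ∂(G.law a b : Measure unitInterval)) ∂P := fun a b => by
    rw [← setIntegral_condExp hle (hWg a b) hS]
    refine setIntegral_congr_ae (hle S hS) ?_
    -- The weight is known before the round, so it comes out of the conditional expectation.
    have h1 := condExp_stronglyMeasurable_mul_of_bound (μ := P) hle (hWm a b).stronglyMeasurable
      (hg a b) C (Filter.Eventually.of_forall fun ω => hWb a b ω)
    filter_upwards [h1, hcond a b] with ω h1 h2 _
    change P[W a b * g a b | 𝓕 t] ω = _
    rw [h1, Pi.mul_apply, h2]
  have hint : ∀ a b, Integrable (fun ω => W a b ω * (μ t ω a * ν t ω b *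
      ∫ x, φ x ∂(G.law a b : Measure unitInterval))) P := fun a b => by
    refine (Integrable.mul_const (Integrable.of_bound ((hpm a b).mono hle le_rfl).aestronglyMeasurable
      1 (Filter.Eventually.of_forall fun ω => ?_)) _).bdd_mul
      ((hWm a b).mono hle le_rfl).aestronglyMeasurable
      (Filter.Eventually.of_forall fun ω => hWb a b ω)
    rw [Real.norm_eq_abs, abs_of_nonneg (hp0 a b ω)]
    exact hp1 a b ω
  constructor
  · rw [hdecomp]
    exact integrable_finsetSum _ fun a _ => integrable_finsetSum _ fun b _ => hWg a b
  · rw [hdecomp, integral_finsetSum _ fun a _ => (integrable_finsetSum _ fun b _ =>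
      (hWg a b).integrableOn), integral_finsetSum _ fun a _ => (integrable_finsetSum _ fun b _ =>
      (hint a b).integrableOn)]
    refine Finset.sum_congr rfl fun a _ => ?_
    rw [integral_finsetSum _ fun b _ => (hWg a b).integrableOn,
      integral_finsetSum _ fun b _ => (hint a b).integrableOn]
    exact Finset.sum_congr rfl fun b _ => hterm a b

end BanditPlay

/-! ### Deterministic lower bounds on the policies, for integrability. -/

section LowerBound

variable {I : Type*} [Fintype I]

theorem abs_sub_le_one {x w : I → ℝ} (hx : x ∈ posSimplex I)
    (hw : w ∈ posSimplex I) (i : I) : |x i - w i| ≤ 1 := by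
  rw [abs_le]
  have := hx.1 i
  have := hw.1 i
  have := posSimplex_le_one hx i
  have := posSimplex_le_one hw i
  constructor <;> linarith

theorem logDiv_le_of_lower_bound {κ κ' : ℝ} {x w : I → ℝ} (hx : x ∈ posSimplex I)
    (hw : w ∈ posSimplex I) (hκ : 0 < κ) (hκ' : 0 < κ') (hxκ : ∀ i, κ' ≤ x i)
    (hwκ : ∀ i, κ ≤ w i) : logDiv x w ≤ Fintype.card I * (1 / (κ' * κ)) := by
  refine (logDiv_le_sum_sq hx.1 hw.1).trans ?_
  calc ∑ i, (x i - w i) ^ 2 / (x i * w i) ≤ ∑ _i : I, 1 / (κ' * κ) := by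
        refine Finset.sum_le_sum fun i _ => ?_
        have h1 : (x i - w i) ^ 2 ≤ 1 := by
          rw [sq_le_one_iff_abs_le_one]
          exact abs_sub_le_one hx hw i
        have := hxκ i
        have := hwκ i
        have := (hx.1 i).le
        gcongr
    _ = _ := by rw [Finset.sum_const, Finset.card_univ, nsmul_eq_mul]

theorem exists_pos_lower_bound {x : I → ℝ} (hx : x ∈ posSimplex I) : ∃ κ, 0 < κ ∧ ∀ i, κ ≤ x i := by
  have := nonempty_of_mem_posSimplex hx
  obtain ⟨i, hi⟩ := Finite.exists_min x
  exact ⟨x i, hx.1 i, hi⟩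

theorem IsAlgorithmRun.mem_posSimplex [DecidableEq I] [Nonempty I] {η τ δ : ℝ} {T₀ : ℕ}
    {act : ℕ → I} {x : ℕ → ℝ} {w : ℕ → I → ℝ} (h : IsAlgorithmRun η τ δ T₀ act x w) (t : ℕ) :
    w t ∈ posSimplex I := by
  cases t with
  | zero =>
    have : w 0 = fun _ : I => 1 / (Fintype.card I : ℝ) := funext h.init
    rw [this]; exact uniform_mem_posSimplex
  | succ t => exact (h.step t).1

/-- The policies of a round are bounded below uniformly in the outcomes. -/
theorem IsAlgorithmRun.exists_lower_bound [DecidableEq I] [Nonempty I] {K : ℕ} {δ' ε η τ δ : ℝ}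
    {T₀ : ℕ} (hS : GoodSchedule K δ' ε (learningRate η T₀) (regStrength τ δ T₀)) {Ω : Type*}
    {act : ℕ → Ω → I} {x : ℕ → Ω → ℝ} {w : ℕ → Ω → I → ℝ}
    (h : ∀ ω, IsAlgorithmRun η τ δ T₀ (fun t => act t ω) (fun t => x t ω) (fun t => w t ω))
    (hx : ∀ t ω, x t ω ∈ Set.Icc (0 : ℝ) 1) (t : ℕ) :
    ∃ κ, 0 < κ ∧ ∀ ω i, κ ≤ w t ω i := by
  have hm : (0 : ℝ) < Fintype.card I := by exact_mod_cast Fintype.card_pos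
  induction t with
  | zero => exact ⟨1 / (Fintype.card I : ℝ), by positivity, fun ω i => ((h ω).init i).ge⟩
  | succ t ih =>
    obtain ⟨κ, hκ, hw⟩ := ih
    set m : ℝ := (Fintype.card I : ℝ)
    set ηt := learningRate η T₀ t
    set τt := regStrength τ δ T₀ t
    have hη : 0 < ηt := hS.eta_pos t
    have hτ : 0 < τt := hS.tau_pos t
    -- An outcome-independent bound on the divergence from the uniform policy after the step; it
    -- bounds `1 / (m w i)` by `(1 + √C)²`.
    set C : ℝ := m * (1 / (1 / m * κ)) + ηt * (1 / κ) + m * (ηt * τt)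
      + (4 * ηt ^ 2 + 4 * m * (ηt * τt) ^ 2)
    have hC : 0 ≤ C := by positivity
    refine ⟨1 / m / (1 + √C) ^ 2, by positivity, fun ω i => ?_⟩
    have hy := (h ω).mem_posSimplex t
    have hy' := (h ω).mem_posSimplex (t + 1)
    have hu := uniform_mem_posSimplex (I := I)
    have h1 := ((h ω).step t).logDiv_regularized_le hη (hS.mul_le t) (hx t ω) hy hu
    have h2 := logDiv_le_of_lower_bound hu hy hκ (by positivity : 0 < 1 / m) (fun _ => le_rfl)
      (hw ω)
    have h3 : (1 / m - w t ω (act t ω)) / w t ω (act t ω) * x t ω ≤ 1 / κ := by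
      have a0 := hy.1 (act t ω)
      have a1 := hw ω (act t ω)
      have a2 := posSimplex_le_one hu (act t ω)
      calc (1 / m - w t ω (act t ω)) / w t ω (act t ω) * x t ω
          ≤ 1 / w t ω (act t ω) * x t ω := by
            refine mul_le_mul_of_nonneg_right ?_ (hx t ω).1
            exact div_le_div_of_nonneg_right (by linarith) a0.le
        _ ≤ 1 / w t ω (act t ω) * 1 := mul_le_mul_of_nonneg_left (hx t ω).2 (by positivity)
        _ ≤ 1 / κ := by rw [mul_one]; exact one_div_le_one_div_of_le hκ a1
    have h4 : ∑ i, ηt * τt * (1 - 1 / m / w t ω i) ≤ m * (ηt * τt) := by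
      calc ∑ i, ηt * τt * (1 - 1 / m / w t ω i) ≤ ∑ _i : I, ηt * τt := by
            refine Finset.sum_le_sum fun i _ => mul_le_of_le_one_right (by positivity) ?_
            have : 0 < 1 / m / w t ω i := div_pos (by positivity) (hy.1 i)
            linarith
        _ = _ := by rw [Finset.sum_const, Finset.card_univ, nsmul_eq_mul]
    have h5 : logDiv (fun _ : I => 1 / m) (w (t + 1) ω) ≤ C := by
      have := mul_le_mul_of_nonneg_left h3 hη.le
      refine h1.trans ?_
      linarith
    have hr : 0 < 1 / m / w (t + 1) ω i := div_pos (by positivity) (hy'.1 i)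
    have h6 := (sq_sqrt_sub_one_le hr).trans ((logDiv_term_le hu.1 hy'.1 i).trans h5)
    have h7 := Real.le_sqrt_of_sq_le h6
    have h8 : 1 / m / w (t + 1) ω i ≤ (1 + √C) ^ 2 := by
      rw [← Real.sq_sqrt hr.le]
      exact pow_le_pow_left₀ (Real.sqrt_nonneg _) (by linarith) 2
    rw [div_le_iff₀ (by positivity)]
    have := (div_le_iff₀ (hy'.1 i)).1 h8
    linarith

theorem measurable_logDiv_comp {Ω : Type*} {m : MeasurableSpace Ω} (x : I → ℝ) {w : Ω → I → ℝ}
    (hw : Measurable w) : Measurable fun ω => logDiv x (w ω) := by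
  unfold logDiv
  have h1 : ∀ i, Measurable fun ω => x i / w ω i := fun i =>
    measurable_const.div ((measurable_pi_apply i).comp hw)
  exact Finset.measurable_sum _ fun i _ => ((h1 i).sub_const 1).sub (h1 i).log

end LowerBound

/-! ### Drift of the total divergence and conclusion. -/

section Main

variable {A B Ω : Type*} [Fintype A] [Fintype B] [DecidableEq A] [DecidableEq B]
  [Nonempty A] [Nonempty B] [MeasurableSpace A] [MeasurableSpace B]
  [MeasurableSingletonClass A] [MeasurableSingletonClass B]
  [mΩ : MeasurableSpace Ω] {G : MatrixGame A B} {P : Measure Ω} [IsProbabilityMeasure P]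
  {𝓕 : Filtration ℕ mΩ} {μ : ℕ → Ω → A → ℝ} {ν : ℕ → Ω → B → ℝ}
  {act₁ : ℕ → Ω → A} {act₂ : ℕ → Ω → B} {loss : ℕ → Ω → unitInterval}
  {K : ℕ} {δ' ε η τ δ : ℝ} {T₀ : ℕ}

theorem integrable_logDiv_comp {I : Type*} [Fintype I] {x : I → ℝ} (hx : x ∈ posSimplex I)
    {w : Ω → I → ℝ} (hw : ∀ ω, w ω ∈ posSimplex I) (hwm : Measurable w) {κ : ℝ} (hκ : 0 < κ)
    (hwκ : ∀ ω i, κ ≤ w ω i) : Integrable (fun ω => logDiv x (w ω)) P := by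
  obtain ⟨κ', hκ', hxκ⟩ := exists_pos_lower_bound hx
  refine Integrable.of_bound (measurable_logDiv_comp x hwm).aestronglyMeasurable
    (Fintype.card I * (1 / (κ' * κ))) (Filter.Eventually.of_forall fun ω => ?_)
  rw [Real.norm_eq_abs, abs_of_nonneg (logDiv_nonneg hx.1 (hw ω).1)]
  exact logDiv_le_of_lower_bound hx (hw ω) hκ hκ' hxκ (hwκ ω)

/-- Integrability of the regularization term of the one-step bound. -/
theorem integrable_sum_one_sub_div {I : Type*} [Fintype I] {x : I → ℝ} (hx : x ∈ posSimplex I)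
    {w : Ω → I → ℝ} (hwm : Measurable w) {κ : ℝ} (hκ : 0 < κ)
    (hwκ : ∀ ω i, κ ≤ w ω i) (h : ℝ) : Integrable (fun ω => ∑ i, h * (1 - x i / w ω i)) P := by
  refine integrable_finsetSum _ fun i _ => Integrable.const_mul
    ((integrable_const 1).sub (Integrable.of_bound
      (measurable_const.div ((measurable_pi_apply i).comp hwm)).aestronglyMeasurable (1 / κ)
      (Filter.Eventually.of_forall fun ω => ?_))) h
  have h1 := hwκ ω i
  have h2 : 0 < w ω i := hκ.trans_le h1
  change ‖x i / w ω i‖ ≤ 1 / κ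
  rw [Real.norm_eq_abs, abs_of_pos (div_pos (hx.1 i) h2)]
  exact div_le_div₀ zero_le_one (posSimplex_le_one hx i) hκ h1

theorem integrable_sum_sub_mul_cost {I J : Type*} [Fintype I] [Fintype J] {M : I → J → ℝ}
    (hM : ∀ i j, M i j ∈ Set.Icc (0 : ℝ) 1) {x : I → ℝ} (hx : x ∈ posSimplex I)
    {w : Ω → I → ℝ} (hw : ∀ ω, w ω ∈ posSimplex I) (hwm : Measurable w)
    {q : Ω → J → ℝ} (hq : ∀ ω, q ω ∈ posSimplex J) (hqm : Measurable q) :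
    Integrable (fun ω => ∑ i, (x i - w ω i) * cost M (q ω) i) P := by
  refine integrable_finsetSum _ fun i _ => Integrable.of_bound (Measurable.aestronglyMeasurable
    ((measurable_const.sub ((measurable_pi_apply i).comp hwm)).mul ?_)) 1
    (Filter.Eventually.of_forall fun ω => ?_)
  · unfold cost
    exact Finset.measurable_sum _ fun j _ => ((measurable_pi_apply j).comp hqm).mul_const _
  · have hc := cost_mem hM (hq ω) i
    rw [Real.norm_eq_abs, abs_mul, abs_of_nonneg hc.1]
    exact mul_le_one₀ (abs_sub_le_one hx (hw ω) i) hc.1 hc.2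

theorem abs_sub_div_le {I : Type*} [Fintype I] {x w : I → ℝ} (hx : x ∈ posSimplex I)
    (hw : w ∈ posSimplex I) {κ : ℝ} (hκ : 0 < κ) {i : I} (hwκ : κ ≤ w i) :
    |(x i - w i) / w i| ≤ 1 / κ := by
  rw [abs_div, abs_of_pos (hw.1 i)]
  exact div_le_div₀ zero_le_one (abs_sub_le_one hx hw i) hκ hwκ

/-- The divergence between the reference path and the policies of both players. -/
def totalDiv (G : MatrixGame A B) (ηs τs : ℕ → ℝ) (t : ℕ) (y : A → ℝ) (z : B → ℝ) : ℝ :=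
  logDiv (shadow G.meanLoss ηs τs t).1 y + logDiv (shadow G.meanLoss ηs τs t).2 z

theorem IsBanditPlay.setIntegral_totalDiv_le
    (hS : GoodSchedule K δ' ε (learningRate η T₀) (regStrength τ δ T₀))
    (hK : Fintype.card A + Fintype.card B = K)
    (h : IsBanditPlay G P 𝓕 μ ν act₁ act₂ loss)
    (hA : ∀ ω, IsAlgorithmRun η τ δ T₀ (fun t => act₁ t ω) (fun t => (loss t ω : ℝ))
      (fun t => μ t ω))
    (hB : ∀ ω, IsAlgorithmRun η τ δ T₀ (fun t => act₂ t ω) (fun t => 1 - (loss t ω : ℝ))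
      (fun t => ν t ω)) (t : ℕ) :
    Integrable (fun ω => totalDiv G (learningRate η T₀) (regStrength τ δ T₀) t (μ t ω) (ν t ω)) P ∧
    ∀ S, MeasurableSet[𝓕 t] S →
      ∫ ω in S, totalDiv G (learningRate η T₀) (regStrength τ δ T₀) (t + 1) (μ (t + 1) ω)
          (ν (t + 1) ω) ∂P
        ≤ (1 - learningRate η T₀ t * regStrength τ δ T₀ t / 2)
            * ∫ ω in S, totalDiv G (learningRate η T₀) (regStrength τ δ T₀) t (μ t ω) (ν t ω) ∂P
          + 5 * K * (learningRate η T₀ t ^ 2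
            + (learningRate η T₀ t * regStrength τ δ T₀ t) ^ 2) := by
  have hM := G.meanLoss_mem
  have hl1 : ∀ t ω, (loss t ω : ℝ) ∈ Set.Icc (0 : ℝ) 1 := fun t ω => (loss t ω).2
  have hl2 : ∀ t ω, 1 - (loss t ω : ℝ) ∈ Set.Icc (0 : ℝ) 1 := fun t ω =>
    ⟨by linarith [(hl1 t ω).2], by linarith [(hl1 t ω).1]⟩
  have hy : ∀ t ω, μ t ω ∈ posSimplex A := fun t ω => (hA ω).mem_posSimplex t
  have hz : ∀ t ω, ν t ω ∈ posSimplex B := fun t ω => (hB ω).mem_posSimplex t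
  have hym : ∀ t, Measurable (μ t) := fun t => (h.measurable_policy₁ t).mono (𝓕.le t) le_rfl
  have hzm : ∀ t, Measurable (ν t) := fun t => (h.measurable_policy₂ t).mono (𝓕.le t) le_rfl
  have hint : ∀ t, Integrable (fun ω =>
      totalDiv G (learningRate η T₀) (regStrength τ δ T₀) t (μ t ω) (ν t ω)) P := fun t => by
    obtain ⟨κ₁, hκ₁, hb₁⟩ := IsAlgorithmRun.exists_lower_bound hS hA hl1 t
    obtain ⟨κ₂, hκ₂, hb₂⟩ := IsAlgorithmRun.exists_lower_bound hS hB hl2 t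
    have hinv := hS.shadow_invariant hK hM t
    exact (integrable_logDiv_comp hinv.1 (hy t) (hym t) hκ₁ hb₁).add
      (integrable_logDiv_comp hinv.2.1 (hz t) (hzm t) hκ₂ hb₂)
  refine ⟨hint t, fun S hSm => ?_⟩
  obtain ⟨κ₁, hκ₁, hb₁⟩ := IsAlgorithmRun.exists_lower_bound hS hA hl1 t
  obtain ⟨κ₂, hκ₂, hb₂⟩ := IsAlgorithmRun.exists_lower_bound hS hB hl2 t
  have hinv := hS.shadow_invariant hK hM t
  have hinv' := hS.shadow_invariant hK hM (t + 1)
  have hu := hS.abs_residual_fst_le hK hM t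
  have hv := hS.abs_residual_snd_le hK hM t
  have hη := hS.eta_pos t
  have hτ := hS.tau_pos t
  have hh1 := hS.mul_le t
  set ηs := learningRate η T₀
  set τs := regStrength τ δ T₀
  set x' := (shadow G.meanLoss ηs τs (t + 1)).1 with hx'_def
  set q' := (shadow G.meanLoss ηs τs (t + 1)).2 with hq'_def
  -- The part of the one-step bound that is known before the round. The comparison point is already
  -- the next point of the path, whose own motion is accounted for in `hdrift`.
  set R : Ω → ℝ := fun ω =>
    (logDiv x' (μ t ω) + ∑ a, ηs t * τs t * (1 - x' a / μ t ω a)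
      + (4 * ηs t ^ 2 + 4 * Fintype.card A * (ηs t * τs t) ^ 2))
    + (logDiv q' (ν t ω) + ∑ b, ηs t * τs t * (1 - q' b / ν t ω b)
      + (4 * ηs t ^ 2 + 4 * Fintype.card B * (ηs t * τs t) ^ 2)) with hR_def
  have hRint : Integrable R P :=
    (((integrable_logDiv_comp hinv'.1 (hy t) (hym t) hκ₁ hb₁).add
      (integrable_sum_one_sub_div hinv'.1 (hym t) hκ₁ hb₁ _)).add (integrable_const _)).add
    (((integrable_logDiv_comp hinv'.2.1 (hz t) (hzm t) hκ₂ hb₂).add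
      (integrable_sum_one_sub_div hinv'.2.1 (hzm t) hκ₂ hb₂ _)).add (integrable_const _))
  have hmf₁ : ∀ a, Measurable[𝓕 t] fun ω => μ t ω a := fun a =>
    (measurable_pi_apply a).comp (h.measurable_policy₁ t)
  have hmf₂ : ∀ b, Measurable[𝓕 t] fun ω => ν t ω b := fun b =>
    (measurable_pi_apply b).comp (h.measurable_policy₂ t)
  obtain ⟨hi₁, he₁⟩ := h.setIntegral_eq (hy t) (hz t)
    (W := fun a _ ω => (x' a - μ t ω a) / μ t ω a)
    (fun a _ => (measurable_const.sub (hmf₁ a)).div (hmf₁ a))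
    (fun a _ ω => abs_sub_div_le hinv'.1 (hy t ω) hκ₁ (hb₁ ω a))
    (φ := fun x => (x : ℝ)) continuous_subtype_val hSm
  obtain ⟨hi₂, he₂⟩ := h.setIntegral_eq (hy t) (hz t)
    (W := fun _ b ω => (q' b - ν t ω b) / ν t ω b)
    (fun _ b => (measurable_const.sub (hmf₂ b)).div (hmf₂ b))
    (fun _ b ω => abs_sub_div_le hinv'.2.1 (hz t ω) hκ₂ (hb₂ ω b))
    (φ := fun x => 1 - (x : ℝ)) (continuous_const.sub continuous_subtype_val) hSm
  -- The importance weight cancels the probability of the action, so the estimate is unbiased for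
  -- the cost vector.
  have hc₁ : ∀ ω, ∑ a, ∑ b, (x' a - μ t ω a) / μ t ω a * (μ t ω a * ν t ω b *
      ∫ x, (x : ℝ) ∂(G.law a b : Measure unitInterval))
      = ∑ a, (x' a - μ t ω a) * cost G.meanLoss (ν t ω) a := fun ω => by
    refine Finset.sum_congr rfl fun a _ => ?_
    rw [cost, Finset.mul_sum]
    refine Finset.sum_congr rfl fun b _ => ?_
    have := ((hy t ω).1 a).ne'
    rw [MatrixGame.meanLoss]; field_simp
  have hlawint : ∀ a b, ∫ x, (1 - (x : ℝ)) ∂(G.law a b : Measure unitInterval)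
      = coLoss G.meanLoss b a := fun a b => by
    have hid : Integrable (fun x : unitInterval => (x : ℝ)) (G.law a b : Measure unitInterval) :=
      integrable_comp_unitInterval continuous_subtype_val measurable_id
    rw [integral_sub (integrable_const _) hid]
    simp [coLoss, MatrixGame.meanLoss]
  have hc₂ : ∀ ω, ∑ a, ∑ b, (q' b - ν t ω b) / ν t ω b * (μ t ω a * ν t ω b *
      ∫ x, (1 - (x : ℝ)) ∂(G.law a b : Measure unitInterval))
      = ∑ b, (q' b - ν t ω b) * cost (coLoss G.meanLoss) (μ t ω) b := fun ω => by
    rw [Finset.sum_comm]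
    refine Finset.sum_congr rfl fun b _ => ?_
    rw [cost, Finset.mul_sum]
    refine Finset.sum_congr rfl fun a _ => ?_
    have := ((hz t ω).1 b).ne'
    rw [hlawint]; field_simp
  simp only [hc₁] at he₁
  simp only [hc₂] at he₂
  have hg₁ := integrable_sum_sub_mul_cost (P := P) hM hinv'.1 (hy t) (hym t) (hz t) (hzm t)
  have hg₂ := integrable_sum_sub_mul_cost (P := P) (coLoss_mem hM) hinv'.2.1 (hz t) (hzm t) (hy t)
    (hym t)
  have hpath : ∀ ω, totalDiv G ηs τs (t + 1) (μ (t + 1) ω) (ν (t + 1) ω)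
      ≤ R ω + ηs t * ((x' (act₁ t ω) - μ t ω (act₁ t ω)) / μ t ω (act₁ t ω) * (loss t ω : ℝ))
        + ηs t * ((q' (act₂ t ω) - ν t ω (act₂ t ω)) / ν t ω (act₂ t ω)
          * (1 - (loss t ω : ℝ))) := fun ω => by
    have h1 := ((hA ω).step t).logDiv_regularized_le hη hh1 (hl1 t ω) (hy t ω) hinv'.1
    have h2 := ((hB ω).step t).logDiv_regularized_le hη hh1 (hl2 t ω) (hz t ω) hinv'.2.1
    simp only [totalDiv, hR_def]
    linarith
  have hdrift : ∀ ω, R ω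
      + ηs t * ∑ a, (x' a - μ t ω a) * cost G.meanLoss (ν t ω) a
      + ηs t * ∑ b, (q' b - ν t ω b) * cost (coLoss G.meanLoss) (μ t ω) b
      ≤ (1 - ηs t * τs t / 2) * totalDiv G ηs τs t (μ t ω) (ν t ω)
        + 5 * K * (ηs t ^ 2 + (ηs t * τs t) ^ 2) := fun ω => by
    have h1 := logDiv_joint_drift_le hM hτ hη rfl hh1 hinv.1 (hy t ω) hinv.2.1 (hz t ω) hu hv
    rw [← Nat.cast_add, hK] at h1
    refine le_trans (le_of_eq ?_) h1
    simp only [hR_def, hx'_def, hq'_def, shadow]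
    ring
  have hsplit : ∀ {f g k : Ω → ℝ} {c : ℝ}, Integrable f P → Integrable g P → Integrable k P →
      ∫ ω in S, (f ω + c * g ω + c * k ω) ∂P
        = ∫ ω in S, f ω ∂P + c * ∫ ω in S, g ω ∂P + c * ∫ ω in S, k ω ∂P := by
    intro f g k c hf hg hk
    have hg' := (hg.const_mul c).integrableOn (s := S)
    have hk' := (hk.const_mul c).integrableOn (s := S)
    have hfg : Integrable (fun ω => f ω + c * g ω) (P.restrict S) := hf.integrableOn.add hg'
    rw [integral_add hfg hk', integral_add hf.integrableOn hg', integral_const_mul,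
      integral_const_mul]
  have hbound : Integrable (fun ω => (1 - ηs t * τs t / 2) * totalDiv G ηs τs t (μ t ω) (ν t ω)
        + 5 * K * (ηs t ^ 2 + (ηs t * τs t) ^ 2)) P :=
    ((hint t).const_mul _).add (integrable_const _)
  calc ∫ ω in S, totalDiv G ηs τs (t + 1) (μ (t + 1) ω) (ν (t + 1) ω) ∂P
      ≤ ∫ ω in S, (R ω
        + ηs t * ((x' (act₁ t ω) - μ t ω (act₁ t ω)) / μ t ω (act₁ t ω) * (loss t ω : ℝ))
        + ηs t * ((q' (act₂ t ω) - ν t ω (act₂ t ω)) / ν t ω (act₂ t ω)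
          * (1 - (loss t ω : ℝ)))) ∂P :=
        integral_mono (hint (t + 1)).integrableOn
          ((hRint.add (hi₁.const_mul _)).add (hi₂.const_mul _)).integrableOn hpath
    _ = ∫ ω in S, (R ω
        + ηs t * ∑ a, (x' a - μ t ω a) * cost G.meanLoss (ν t ω) a
        + ηs t * ∑ b, (q' b - ν t ω b) * cost (coLoss G.meanLoss) (μ t ω) b) ∂P := by
        rw [hsplit hRint hi₁ hi₂, hsplit hRint hg₁ hg₂, he₁, he₂]
    _ ≤ ∫ ω in S, ((1 - ηs t * τs t / 2) * totalDiv G ηs τs t (μ t ω) (ν t ω)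
        + 5 * K * (ηs t ^ 2 + (ηs t * τs t) ^ 2)) ∂P :=
        integral_mono ((hRint.add (hg₁.const_mul _)).add (hg₂.const_mul _)).integrableOn
          hbound.integrableOn hdrift
    _ = (1 - ηs t * τs t / 2) * ∫ ω in S, totalDiv G ηs τs t (μ t ω) (ν t ω) ∂P
        + P.real S * (5 * K * (ηs t ^ 2 + (ηs t * τs t) ^ 2)) := by
        rw [integral_add ((hint t).const_mul _).integrableOn (integrable_const _).integrableOn,
          integral_const_mul, setIntegral_const, smul_eq_mul]
    _ ≤ _ := by
        exact add_le_add le_rfl (mul_le_of_le_one_left (by positivity) measureReal_le_one)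

end Main

theorem one_sub_le_measureReal_exploitabilityGap_le {A B Ω : Type*} [Fintype A] [Fintype B]
    [DecidableEq A] [DecidableEq B] [Nonempty A] [Nonempty B] [MeasurableSpace A]
    [MeasurableSpace B] [MeasurableSingletonClass A] [MeasurableSingletonClass B]
    [mΩ : MeasurableSpace Ω] {G : MatrixGame A B} {P : Measure Ω} [IsProbabilityMeasure P]
    {𝓕 : Filtration ℕ mΩ} {μ : ℕ → Ω → A → ℝ} {ν : ℕ → Ω → B → ℝ}
    {act₁ : ℕ → Ω → A} {act₂ : ℕ → Ω → B} {loss : ℕ → Ω → unitInterval}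
    {K : ℕ} {ε η τ δ : ℝ} {T₀ : ℕ}
    (hS : GoodSchedule K δ ε (learningRate η T₀) (regStrength τ δ T₀))
    (hK : Fintype.card A + Fintype.card B = K)
    (h : IsBanditPlay G P 𝓕 μ ν act₁ act₂ loss)
    (hA : ∀ ω, IsAlgorithmRun η τ δ T₀ (fun t => act₁ t ω) (fun t => (loss t ω : ℝ))
      (fun t => μ t ω))
    (hB : ∀ ω, IsAlgorithmRun η τ δ T₀ (fun t => act₂ t ω) (fun t => 1 - (loss t ω : ℝ))
      (fun t => ν t ω)) :
    1 - δ ≤ P.real {ω | ∀ t : ℕ,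
      G.exploitabilityGap (μ t ω) (ν t ω) ≤ 2 * K * regStrength τ δ T₀ t} := by
  have hy : ∀ t ω, μ t ω ∈ posSimplex A := fun t ω => (hA ω).mem_posSimplex t
  have hz : ∀ t ω, ν t ω ∈ posSimplex B := fun t ω => (hB ω).mem_posSimplex t
  have hinv := hS.shadow_invariant hK G.meanLoss_mem
  have hθ : ∀ t, 0 < regStrength τ δ T₀ t ^ 2 / 16 := fun t =>
    div_pos (pow_pos (hS.tau_pos t) 2) (by norm_num)
  have hD0 : ∀ t ω, 0 ≤ totalDiv G (learningRate η T₀) (regStrength τ δ T₀) t (μ t ω) (ν t ω) :=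
    fun t ω => add_nonneg (logDiv_nonneg (hinv t).1.1 (hy t ω).1)
      (logDiv_nonneg (hinv t).2.1.1 (hz t ω).1)
  have hstep := h.setIntegral_totalDiv_le hS hK hA hB
  have hmax := one_sub_le_measureReal_forall_le (P := P) 𝓕
    (Y := fun t ω => totalDiv G (learningRate η T₀) (regStrength τ δ T₀) t (μ t ω) (ν t ω)
      / (regStrength τ δ T₀ t ^ 2 / 16))
    (e := fun t => 80 * K * (learningRate η T₀ t ^ 2
      + (learningRate η T₀ t * regStrength τ δ T₀ t) ^ 2) / regStrength τ δ T₀ (t + 1) ^ 2)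
    (δ := δ)
    (fun t => ((measurable_logDiv_comp _ (h.measurable_policy₁ t)).add
      (measurable_logDiv_comp _ (h.measurable_policy₂ t))).div_const _)
    (fun t => (hstep t).1.div_const _) (fun t ω => div_nonneg (hD0 t ω) (hθ t).le) (fun ω => ?_)
    (fun t S hSm => ?_) hS.budget
  · refine hmax.trans (measureReal_mono fun ω hω t => ?_)
    have h1 := (div_le_one (hθ t)).1 (hω t)
    have h2 := G.exploitabilityGap_le (hS.tau_pos t) (hinv t).1 (hy t ω) (hinv t).2.1 (hz t ω)
      (hS.abs_residual_fst_le hK G.meanLoss_mem t) (hS.abs_residual_snd_le hK G.meanLoss_mem t) h1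
    rwa [← Nat.cast_add, hK] at h2
  -- The path and the policies share the uniform start, so the initial divergence is zero.
  · have h1 : μ 0 ω = fun _ : A => 1 / (Fintype.card A : ℝ) := funext (hA ω).init
    have h2 : ν 0 ω = fun _ : B => 1 / (Fintype.card B : ℝ) := funext (hB ω).init
    simp [totalDiv, shadow, h1, h2, logDiv]
  · have h1 := (hstep t).2 S hSm
    have hI : 0 ≤ ∫ ω in S, totalDiv G (learningRate η T₀) (regStrength τ δ T₀) t (μ t ω) (ν t ω) ∂P :=
      integral_nonneg (hD0 t)
    rw [integral_div, integral_div]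
    set I := ∫ ω in S, totalDiv G (learningRate η T₀) (regStrength τ δ T₀) t (μ t ω) (ν t ω) ∂P
    -- The contraction compensates the shrinking of the normalization `τ² / 16`; the remaining error
    -- becomes `80 K = 16 · 5 K` over `τ²`.
    have h2 : (1 - learningRate η T₀ t * regStrength τ δ T₀ t / 2) * I
        / (regStrength τ δ T₀ (t + 1) ^ 2 / 16) ≤ I / (regStrength τ δ T₀ t ^ 2 / 16) := by
      rw [div_le_div_iff₀ (hθ (t + 1)) (hθ t)]
      have := mul_le_mul_of_nonneg_left (hS.contraction t) hI
      linarith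
    refine (div_le_div_of_nonneg_right h1 (hθ (t + 1)).le).trans ?_
    rw [add_div]
    refine add_le_add h2 (le_of_eq ?_)
    have := (hS.tau_pos (t + 1)).ne'
    field_simp
    ring

end

theorem mainTheorem1 (K : ℕ) (δ : ℝ) (hδ : 0 < δ) :
    ∃ c : ℝ, 0 < c ∧
      ∀ (A : Type*) (B : Type*) [Fintype A] [Fintype B] [DecidableEq A] [DecidableEq B]
        [Nonempty A] [Nonempty B] [MeasurableSpace A] [MeasurableSpace B]
        [MeasurableSingletonClass A] [MeasurableSingletonClass B],
        Fintype.card A + Fintype.card B = K →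
      ∀ (η τ : ℝ) (T₀ : ℕ), ParameterCondition c δ η τ T₀ →
      ∀ (G : MatrixGame A B) (Ω : Type*) [mΩ : MeasurableSpace Ω] (P : Measure Ω)
        [IsProbabilityMeasure P] (𝓕 : Filtration ℕ mΩ)
        (μ : ℕ → Ω → A → ℝ) (ν : ℕ → Ω → B → ℝ)
        (act₁ : ℕ → Ω → A) (act₂ : ℕ → Ω → B) (loss : ℕ → Ω → unitInterval),
        IsBanditPlay G P 𝓕 μ ν act₁ act₂ loss →
        (∀ ω, IsAlgorithmRun η τ δ T₀ (fun t => act₁ t ω) (fun t => (loss t ω : ℝ))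
          (fun t => μ t ω)) →
        (∀ ω, IsAlgorithmRun η τ δ T₀ (fun t => act₂ t ω) (fun t => 1 - (loss t ω : ℝ))
          (fun t => ν t ω)) →
        1 - δ ≤ P.real {ω | ∀ t : ℕ, G.exploitabilityGap (μ t ω) (ν t ω) ≤
          2 * K * τ * Real.log (((t : ℝ) + T₀) / δ) * ((t : ℝ) + T₀) ^ (-(1 / 4) : ℝ)} := by
  -- For `δ ≥ 1` the probability bound is trivial, and `K = 0` is impossible with nonempty action
  -- sets.
  rcases le_or_gt 1 δ with hδ1 | hδ1
  · refine ⟨1, one_pos, ?_⟩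
    intro A B _ _ _ _ _ _ _ _ _ _ _ η τ T₀ _ G Ω mΩ P _ 𝓕 μ ν act₁ act₂ loss _ _ _
    exact (sub_nonpos.2 hδ1).trans measureReal_nonneg
  rcases Nat.eq_zero_or_pos K with rfl | hK
  · refine ⟨1, one_pos, ?_⟩
    intro A B _ _ _ _ _ _ _ _ _ _ hcard
    have : 0 < Fintype.card A := Fintype.card_pos
    omega
  obtain ⟨c, hc, ε, hgood⟩ := ParameterCondition.goodSchedule hK hδ hδ1
  refine ⟨c, hc, ?_⟩
  intro A B _ _ _ _ _ _ _ _ _ _ hcard η τ T₀ hpar G Ω mΩ P _ 𝓕 μ ν act₁ act₂ loss hplay hA hB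
  have h := one_sub_le_measureReal_exploitabilityGap_le (hgood η τ T₀ hpar) hcard hplay hA hB
  simpa only [regStrength, mul_assoc] using h
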